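/- Let $A$ be a set of actions. Star expressions over $A$ are given by $e ::= 0 \mid 1 \mid a \mid e_1+e_2 \mid e_1\cdot e_2 \mid e^*$ ($a\in A$). Write $e{\downarrow}$ ($e$ permits immediate termination) for the least predicate with: $1{\downarrow}$; $(e_1+e_2){\downarrow}$ if $e_1{\downarrow}$ or $e_2{\downarrow}$; $(e_1\cdot e_2){\downarrow}$ if $e_1{\downarrow}$ and $e_2{\downarrow}$; $(e^*){\downarrow}$. Let $\mathsf{Mil}^-$ be the proof system for equations between star expressions with the rules of equational logic (reflexivity, symmetry, transitivity, closure under contexts) and the axioms $(e+f)+g=e+(f+g)$, $e+0=e$, $e+f=f+e$, $e+e=e$, $(e\cdot f)\cdot g=e\cdot(f\cdot g)$, $(e+f)\cdot g=e\cdot g+f\cdot g$, $1\cdot e=e$, $e\cdot 1=e$, $0\cdot e=0$, $e^*=1+e\cdot e^*$, $e^*=(1+e)^*$. For a set $\Gamma$ of equations, $\mathsf{Mil}^-+\Gamma$ has the equations in $\Gamma$ as additional axioms. A 1-chart has a finite set of vertices, a start vertex, transitions with labels in $A\cup\{\mathbf 1\}$ (where $\mathbf 1\notin A$ is the empty step label),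 and a set of vertices with immediate termination. It is weakly guarded if it has no cycle of $\mathbf 1$-transitions. A provable solution, in a proof system, of a 1-chart is a function $s$ from vertices to star expressions such that at every vertex $v$, with transitions $v\xrightarrow{\alpha_i}v_i$ ($1\le i\le n$), the equation $s(v)=\tau(v)+\sum_{i=1}^n\alpha_i\cdot s(v_i)$ is provable, where $\tau(v)$ is $1$ if $v$ permits immediate termination and $0$ otherwise, and the label $\mathbf 1$ is read as the star expression $1$. A coinductive proof of $e_1=e_2$ is a weakly guarded 1-chart whose vertices are labeled by equations, such that the left-hand sides and the right-hand sides each form a provable solution, and such that $e_1=e_2$ is the equation at the start vertex. A loop 1-chart is a 1-chart with an infinite path from its start vertex, in which every infinite path from the start vertex returns to it after a positive number of transitions, and in which only the start vertex may permit immediate termination. A LLEE-witness of a 1-chart labels each transition by a marking label $n\in\mathbb N$ such that: for all $n\geq 1$, and every vertex $v$ from which transitions with marking label $n$ depart, these transitions and all paths that continue from them until $v$ is reached again, in what remains of the 1-chart after removing all transitions with marking labels $1,\dots,n-1$, form a loop 1-chart with start vertex $v$; from vertices other than $v$ of this loop 1-chart there depart only transitions with marking labels $<n$; and there is no infinite path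 from the start vertex that consists of transitions with marking label $0$. A coinductive proof is LLEE-witnessed if its 1-chart has a LLEE-witness. Stacked star expressions are given by $E ::= 0\mid 1\mid a\mid e_1+e_2\mid E\cdot e\mid e^*\mid E\circledast e^*$, where $e,e_1,e_2$ are star expressions; $\pi$ replaces every $\circledast$ by $\cdot$. Consider the following marked transitions, with $a\in A$, $\alpha\in A\cup\{\mathbf 1\}$ and marking labels $l\in\mathbb N$: $a\xrightarrow{a}_0 1$; if $e_i\xrightarrow{a}_l E'$ then $e_1+e_2\xrightarrow{a}_0E'$ ($i=1,2$); if $e\xrightarrow{a}_lE'$ then $e^*\xrightarrow{a}_nE'\circledast e^*$, where $n$ is the star height of $e^*$ if $e$ has a path of positive length to an expression that permits immediate termination, in the transition system on star expressions generated by the usual rules $a\xrightarrow{a}1$; $e_1+e_2\xrightarrow{a}e'$ if $e_i\xrightarrow{a}e'$ for some $i\in\{1,2\}$; $e_1\cdot e_2\xrightarrow{a}e_1'\cdot e_2$ if $e_1\xrightarrow{a}e_1'$; $e_1\cdot e_2\xrightarrow{a}e_2'$ if $e_1{\downarrow}$ and $e_2\xrightarrow{a}e_2'$; $e^*\xrightarrow{a}e'\cdot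 e^*$ if $e\xrightarrow{a}e'$; and $n=0$ otherwise; if $E\xrightarrow{\alpha}_lE'$ then $E\cdot e\xrightarrow{\alpha}_lE'\cdot e$ and $E\circledast e^*\xrightarrow{\alpha}_lE'\circledast e^*$; if $E$ is a star expression with $E{\downarrow}$ then $E\circledast e^*\xrightarrow{\mathbf 1}_0e^*$, and $E\cdot e\xrightarrow{a}_0E'$ whenever $e\xrightarrow{a}_lE'$. The 1-chart interpretation $\underline{\mathcal C}(e)$ of a star expression $e$ has start vertex $e$, and consists of all stacked star expressions that are reachable from $e$ with these transitions, where precisely the star expressions $h$ (without $\circledast$) with $h{\downarrow}$ permit immediate termination. Write $\partial^+(e)$ for the set of stacked star expressions that are reachable from $e$ by a positive number of transitions. **Statement.** Let $e,f,g$ be star expressions over $A$ such that $f$ does not permit immediate termination, and let $\Gamma=\{e=f\cdot e+g\}$. Then: 1. The set of vertices of $\underline{\mathcal C}(f^*\cdot g)$ is $\{f^*\cdot g\}\cup\{(F\circledast f^*)\cdot g\mid F\in\partial^+(f)\}\cup\partial^+(g)$. 2. The marking labels of the transitions of $\underline{\mathcal C}(f^*\cdot g)$ form a LLEE-witness of $\underline{\mathcal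 C}(f^*\cdot g)$. 3. There is a LLEE-witnessed coinductive proof of $e=f^*\cdot g$ over $\mathsf{Mil}^-+\Gamma$ with underlying 1-chart $\underline{\mathcal C}(f^*\cdot g)$, in which the equation at the vertex $f^*\cdot g$ has left-hand side $e$, the equation at each vertex $(F\circledast f^*)\cdot g$ with $F\in\partial^+(f)$ has left-hand side $\pi(F)\cdot e$, the equation at each vertex $G\in\partial^+(g)$ has left-hand side $\pi(G)$, and the equation at every vertex $E$ has right-hand side $\pi(E)$. -/

import Mathlib

universe u

/-- Star expressions over the set `A` of actions. -/
inductive StarExp (A : Type u) : Type u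
  | zero : StarExp A
  | one : StarExp A
  | act : A → StarExp A
  | add : StarExp A → StarExp A → StarExp A
  | mul : StarExp A → StarExp A → StarExp A
  | star : StarExp A → StarExp A

namespace StarExp

variable {A : Type u}

/-- The syntactic star height. -/
def starHeight : StarExp A → ℕ
  | zero => 0
  | one => 0
  | act _ => 0
  | add e₁ e₂ => max e₁.starHeight e₂.starHeight
  | mul e₁ e₂ => max e₁.starHeight e₂.starHeight
  | star e => 1 + e.starHeight

/-- The finite sum `(⋯(e₁ + e₂) + ⋯) + eₙ`, which is `0` for `n = 0` and `e₁` for `n = 1`. -/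
def sum : List (StarExp A) → StarExp A
  | [] => zero
  | e :: l => l.foldl add e

/-- `e.Terminates`: the star expression `e` permits immediate termination. -/
inductive Terminates : StarExp A → Prop
  | one : Terminates one
  | add_left (e₁ e₂ : StarExp A) : Terminates e₁ → Terminates (add e₁ e₂)
  | add_right (e₁ e₂ : StarExp A) : Terminates e₂ → Terminates (add e₁ e₂)
  | mul (e₁ e₂ : StarExp A) : Terminates e₁ → Terminates e₂ → Terminates (mul e₁ e₂)
  | star (e : StarExp A) : Terminates (star e)

/-- The transitions `e -a-> e'` of the chart interpretation of star expressions. -/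
inductive Step : StarExp A → A → StarExp A → Prop
  | act (a : A) : Step (act a) a one
  | add_left (e₁ e₂ : StarExp A) (a : A) (e' : StarExp A) :
      Step e₁ a e' → Step (add e₁ e₂) a e'
  | add_right (e₁ e₂ : StarExp A) (a : A) (e' : StarExp A) :
      Step e₂ a e' → Step (add e₁ e₂) a e'
  | mul_left (e₁ e₂ : StarExp A) (a : A) (e' : StarExp A) :
      Step e₁ a e' → Step (mul e₁ e₂) a (mul e' e₂)
  | mul_right (e₁ e₂ : StarExp A) (a : A) (e' : StarExp A) :
      Terminates e₁ → Step e₂ a e' → Step (mul e₁ e₂) a e'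
  | star (e : StarExp A) (a : A) (e' : StarExp A) :
      Step e a e' → Step (star e) a (mul e' (star e))

/-- `nd⁺(e)`: there is a path of positive length from `e` to an expression that permits
immediate termination. -/
def NormedPlus (e : StarExp A) : Prop :=
  ∃ f : StarExp A, Relation.TransGen (fun x y => ∃ a, Step x a y) e f ∧ Terminates f

/-- One-hole contexts of star expressions. -/
inductive Context (A : Type u) : Type u
  | hole : Context A
  | addLeft : Context A → StarExp A → Context A
  | addRight : StarExp A → Context A → Context A
  | mulLeft : Context A → StarExp A → Context A
  | mulRight : StarExp A → Context A → Context A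
  | star : Context A → Context A

/-- Filling the hole of a context. -/
def Context.fill : Context A → StarExp A → StarExp A
  | hole, e => e
  | addLeft c h, e => StarExp.add (c.fill e) h
  | addRight h c, e => StarExp.add h (c.fill e)
  | mulLeft c h, e => StarExp.mul (c.fill e) h
  | mulRight h c, e => StarExp.mul h (c.fill e)
  | star c, e => StarExp.star (c.fill e)

end StarExp

/-- Formal equations `e = f` between star expressions. -/
abbrev StarEq (A : Type u) : Type u := StarExp A × StarExp A

/-- `ELDerivable S e f`: the equation `e = f` is derivable, without assumptions, in the proof
system that has the rules of equational logic and the set `S` of axioms. -/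
inductive ELDerivable {A : Type u} (S : Set (StarEq A)) : StarExp A → StarExp A → Prop
  | ax (e f : StarExp A) : (e, f) ∈ S → ELDerivable S e f
  | refl (e : StarExp A) : ELDerivable S e e
  | symm (e f : StarExp A) : ELDerivable S e f → ELDerivable S f e
  | trans (e f g : StarExp A) : ELDerivable S e f → ELDerivable S f g → ELDerivable S e g
  | cxt (c : StarExp.Context A) (e f : StarExp A) :
      ELDerivable S e f → ELDerivable S (c.fill e) (c.fill f)

open StarExp in
/-- The axioms of the purely equational part `Mil⁻` of Milner's proof system. -/
inductive MilMinusAxiom {A : Type u} : StarEq A → Prop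
  | assoc_add (e f g : StarExp A) : MilMinusAxiom (add (add e f) g, add e (add f g))
  | neutral_add (e : StarExp A) : MilMinusAxiom (add e zero, e)
  | comm_add (e f : StarExp A) : MilMinusAxiom (add e f, add f e)
  | idempot_add (e : StarExp A) : MilMinusAxiom (add e e, e)
  | assoc_mul (e f g : StarExp A) : MilMinusAxiom (mul (mul e f) g, mul e (mul f g))
  | r_distr (e f g : StarExp A) : MilMinusAxiom (mul (add e f) g, add (mul e g) (mul f g))
  | id_left (e : StarExp A) : MilMinusAxiom (mul one e, e)
  | id_right (e : StarExp A) : MilMinusAxiom (mul e one, e)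
  | deadlock (e : StarExp A) : MilMinusAxiom (mul zero e, zero)
  | rec_star (e : StarExp A) : MilMinusAxiom (star e, add one (mul e (star e)))
  | trm_body (e : StarExp A) : MilMinusAxiom (star e, star (add one e))

/-- The set of axioms of `Mil⁻ + Γ`. -/
def milMinusPlus {A : Type u} (Γ : Set (StarEq A)) : Set (StarEq A) :=
  {q | MilMinusAxiom q} ∪ Γ

/-- A 1-chart with actions from `A`. Its transitions have labels in `Option A`, where `none`
is the empty step label `1`, and `some a` is the proper action `a`. -/
structure OneChart (A : Type u) where
  /-- vertices -/
  V : Type u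
  /-- there are only finitely many vertices -/
  finite_V : Finite V
  /-- start vertex -/
  start : V
  /-- labeled transition relation -/
  Trans : V → Option A → V → Prop
  /-- vertices with immediate termination -/
  Term : V → Prop

namespace OneChart

variable {A : Type u}

/-- There is no cycle of 1-transitions. -/
def WeaklyGuarded (C : OneChart A) : Prop :=
  ∀ v : C.V, ¬ Relation.TransGen (fun x y => C.Trans x none y) v v

/-- The star expression that stands for a transition label. -/
def labelExp : Option A → StarExp A
  | none => StarExp.one
  | some a => StarExp.act a

open Classical in
/-- The termination constant at `v`. -/
noncomputable def termConst (C : OneChart A) (v : C.V) : StarExp A :=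
  if C.Term v then StarExp.one else StarExp.zero

/-- `s` is a provable solution of `C` at `v` in the proof system of equational logic with axioms
`S`. Here `l` is a (possibly redundant) list representation of the transitions from `v`; if `S`
contains the axioms of associativity, commutativity, and idempotency of `+`, then the condition
does not depend on the choice of `l`. -/
def IsSolutionAt (S : Set (StarEq A)) (C : OneChart A) (s : C.V → StarExp A) (v : C.V) : Prop :=
  ∃ l : List (Option A × C.V), (∀ t : Option A × C.V, t ∈ l ↔ C.Trans v t.1 t.2) ∧
    ELDerivable S (s v) (StarExp.add (C.termConst v)
      (StarExp.sum (l.map fun t => StarExp.mul (labelExp t.1) (s t.2))))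

/-- `s` is a provable solution of `C` (with principal value `s C.start`). -/
def IsSolution (S : Set (StarEq A)) (C : OneChart A) (s : C.V → StarExp A) : Prop :=
  ∀ v : C.V, C.IsSolutionAt S s v

/-- `p` is an infinite path that starts in the start vertex. -/
def IsInfinitePath (C : OneChart A) (p : ℕ → C.V) : Prop :=
  p 0 = C.start ∧ ∀ i : ℕ, ∃ α : Option A, C.Trans (p i) α (p (i + 1))

/-- Loop 1-charts. -/
def IsLoop (L : OneChart A) : Prop :=
  (∃ p : ℕ → L.V, L.IsInfinitePath p) ∧
  (∀ p : ℕ → L.V, L.IsInfinitePath p → ∃ i : ℕ, 0 < i ∧ p i = L.start) ∧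
  (∀ v : L.V, L.Term v → v = L.start)

/-- The vertices on the paths that start at `v` with a transition in `U`, and continue with
transitions of `C` until `v` is reached again. -/
inductive GenVertex (C : OneChart A) (v : C.V) (U : Option A → C.V → Prop) : C.V → Prop
  | root : GenVertex C v U v
  | entry (α : Option A) (w : C.V) : U α w → GenVertex C v U w
  | body (x : C.V) (α : Option A) (w : C.V) :
      GenVertex C v U x → x ≠ v → C.Trans x α w → GenVertex C v U w

/-- The sub-1-chart of `C` with start vertex `v` that, for a set `U` of transitions from `v`
(given by their labels and targets), consists of all paths that start with a transition in `U`
and continue onward until `v` is reached again. -/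
def generated (C : OneChart A) (v : C.V) (U : Option A → C.V → Prop) : OneChart A where
  V := {w : C.V // GenVertex C v U w}
  finite_V := by
    have := C.finite_V
    infer_instance
  start := ⟨v, GenVertex.root⟩
  Trans x α y := (x.1 = v ∧ U α y.1) ∨ (x.1 ≠ v ∧ C.Trans x.1 α y.1)
  Term x := C.Term x.1

/-- `M` is an entry/body-labeling of `C`: `M v α n w` says that the transition of `C` from `v` to
`w` with label `α` carries the marking label `n`. Transitions with marking label `0` are body
transitions, those with positive marking label are loop-entry transitions. -/
def IsEntryBodyLabeling (C : OneChart A) (M : C.V → Option A → ℕ → C.V → Prop) : Prop :=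
  (∀ v α w, C.Trans v α w ↔ ∃ n, M v α n w) ∧
  (∀ v α w m n, M v α m w → M v α n w → m = n)

/-- What is left of `C` after the first `n` steps of the elimination of loops that is recorded by
`M`: for `1 ≤ i ≤ n`, the transitions with marking label `i` have been removed. Vertices that
became unreachable from the start vertex need not be removed, since neither the loop sub-1-charts
at reachable vertices nor the infinite paths from the start vertex depend on them. -/
def remaining (C : OneChart A) (M : C.V → Option A → ℕ → C.V → Prop) (n : ℕ) : OneChart A where
  V := C.V
  finite_V := C.finite_V
  start := C.start
  Trans x α y := ∃ m, M x α m y ∧ (m = 0 ∨ n < m)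
  Term := C.Term

/-- `M` is a LLEE-witness of `C`: it records a successful run of the layered elimination of loops.
In the `n`-th step, for every vertex `v` from which transitions with marking label `n` depart,
these transitions are the loop-entry transitions of a loop sub-1-chart of the 1-chart that remains
after `n - 1` steps, and they are removed. No transition in the body of this loop sub-1-chart is
removed in the same or in a later step. In the end, when only the body transitions remain, there
is no infinite path. -/
def IsLLEEWitness (C : OneChart A) (M : C.V → Option A → ℕ → C.V → Prop) : Prop :=
  C.IsEntryBodyLabeling M ∧
  (∀ (n : ℕ) (v : C.V), 0 < n → (∃ α w, M v α n w) →
    ((C.remaining M (n - 1)).generated v (fun α w => M v α n w)).IsLoop ∧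
    ∀ x : C.V, (C.remaining M (n - 1)).GenVertex v (fun α w => M v α n w) x → x ≠ v →
      ∀ α m y, M x α m y → m < n) ∧
  ¬ ∃ p : ℕ → C.V, p 0 = C.start ∧ ∀ i : ℕ, ∃ α, M (p i) α 0 (p (i + 1))

/-- `C` is a LLEE-1-chart. -/
def IsLLEE (C : OneChart A) : Prop :=
  ∃ M : C.V → Option A → ℕ → C.V → Prop, C.IsLLEEWitness M

/-- `(C, L)` is a coinductive proof of `e₁ = e₂` over the proof system of equational logic with
axioms `S` (which is assumed to contain the axioms of associativity, commutativity, and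
idempotency of `+`). -/
def IsCoinductiveProof (S : Set (StarEq A)) (C : OneChart A) (L : C.V → StarEq A)
    (e₁ e₂ : StarExp A) : Prop :=
  C.WeaklyGuarded ∧
  C.IsSolution S (fun v => (L v).1) ∧ C.IsSolution S (fun v => (L v).2) ∧
  (L C.start).1 = e₁ ∧ (L C.start).2 = e₂

/-- `(C, L)` is a LLEE-witnessed coinductive proof of `e₁ = e₂`. -/
def IsLLEECoinductiveProof (S : Set (StarEq A)) (C : OneChart A) (L : C.V → StarEq A)
    (e₁ e₂ : StarExp A) : Prop :=
  C.IsCoinductiveProof S L e₁ e₂ ∧ C.IsLLEE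

end OneChart

/-- Stacked star expressions: `E ::= 0 | 1 | a | e₁ + e₂ | E · e | e* | E ⋆ e*`, where `e`, `e₁`,
`e₂` are star expressions. The constructor `stack E e` stands for the stacked product `E ⋆ e*`. -/
inductive StackedExp (A : Type u) : Type u
  | zero : StackedExp A
  | one : StackedExp A
  | act : A → StackedExp A
  | add : StarExp A → StarExp A → StackedExp A
  | mul : StackedExp A → StarExp A → StackedExp A
  | star : StarExp A → StackedExp A
  | stack : StackedExp A → StarExp A → StackedExp A

/-- A star expression as a stacked star expression. -/
def StarExp.toStacked {A : Type u} : StarExp A → StackedExp A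
  | zero => StackedExp.zero
  | one => StackedExp.one
  | act a => StackedExp.act a
  | add e₁ e₂ => StackedExp.add e₁ e₂
  | mul e₁ e₂ => StackedExp.mul e₁.toStacked e₂
  | star e => StackedExp.star e

namespace StackedExp

variable {A : Type u}

/-- The projection `π`, which changes stacked products into products. -/
def proj : StackedExp A → StarExp A
  | zero => StarExp.zero
  | one => StarExp.one
  | act a => StarExp.act a
  | add e₁ e₂ => StarExp.add e₁ e₂
  | mul E e => StarExp.mul E.proj e
  | star e => StarExp.star e
  | stack E e => StarExp.mul E.proj (StarExp.star e)

/-- Immediate termination, for star expressions only. -/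
def Terminates (E : StackedExp A) : Prop :=
  ∃ e : StarExp A, E = e.toStacked ∧ e.Terminates

/-- The marked transitions that define the 1-chart interpretation of star expressions together
with its entry/body-labeling. Here `Step E α n E'` is a transition from `E` to `E'` with action
label `α` (where `none` is the empty step label `1`) and with marking label `n`, where `n = 0`
marks a body transition. -/
inductive Step : StackedExp A → Option A → ℕ → StackedExp A → Prop
  | act (a : A) : Step (act a) (some a) 0 one
  | add_left (e₁ e₂ : StarExp A) (a : A) (n : ℕ) (E' : StackedExp A) :
      Step e₁.toStacked (some a) n E' → Step (add e₁ e₂) (some a) 0 E'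
  | add_right (e₁ e₂ : StarExp A) (a : A) (n : ℕ) (E' : StackedExp A) :
      Step e₂.toStacked (some a) n E' → Step (add e₁ e₂) (some a) 0 E'
  | star_entry (e : StarExp A) (a : A) (n : ℕ) (E' : StackedExp A) :
      Step e.toStacked (some a) n E' → e.NormedPlus →
        Step (star e) (some a) (StarExp.star e).starHeight (stack E' e)
  | star_body (e : StarExp A) (a : A) (n : ℕ) (E' : StackedExp A) :
      Step e.toStacked (some a) n E' → ¬ e.NormedPlus →
        Step (star e) (some a) 0 (stack E' e)
  | mul_left (E : StackedExp A) (e : StarExp A) (α : Option A) (n : ℕ) (E' : StackedExp A) :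
      Step E α n E' → Step (mul E e) α n (mul E' e)
  | stack_left (E : StackedExp A) (e : StarExp A) (α : Option A) (n : ℕ) (E' : StackedExp A) :
      Step E α n E' → Step (stack E e) α n (stack E' e)
  | mul_right (E : StackedExp A) (e : StarExp A) (a : A) (n : ℕ) (E' : StackedExp A) :
      Terminates E → Step e.toStacked (some a) n E' → Step (mul E e) (some a) 0 E'
  | stack_right (E : StackedExp A) (e : StarExp A) :
      Terminates E → Step (stack E e) none 0 (star e)

/-- There is a transition from `E` to `E'`. -/
def Arrow (E E' : StackedExp A) : Prop := ∃ α n, Step E α n E'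

/-- `E` is reachable from the star expression `e` by finitely many (possibly zero) transitions. -/
def IsVertexOf (e : StarExp A) (E : StackedExp A) : Prop :=
  Relation.ReflTransGen Arrow e.toStacked E

/-- `E` is an iterated 1-derivative of the star expression `e`: it is reachable from `e` by a
positive number of transitions. -/
def IsIteratedDerivative (e : StarExp A) (E : StackedExp A) : Prop :=
  Relation.TransGen Arrow e.toStacked E

/-- A finite set that contains the iterated 1-derivatives, needed for finiteness only. -/
def derivBound : StarExp A → Set (StackedExp A)
  | StarExp.zero => ∅
  | StarExp.one => ∅
  | StarExp.act _ => {one}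
  | StarExp.add e₁ e₂ => derivBound e₁ ∪ derivBound e₂
  | StarExp.mul e₁ e₂ => (fun X => mul X e₂) '' derivBound e₁ ∪ derivBound e₂
  | StarExp.star e => (fun X => stack X e) '' derivBound e ∪ {star e}

theorem derivBound_finite (e : StarExp A) : (derivBound e).Finite := by
  induction e with
  | zero => exact Set.finite_empty
  | one => exact Set.finite_empty
  | act a => exact Set.finite_singleton _
  | add e₁ e₂ h₁ h₂ => exact h₁.union h₂
  | mul e₁ e₂ h₁ h₂ => exact (h₁.image _).union h₂
  | star e h => exact (h.image _).union (Set.finite_singleton _)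

theorem Step.mem_derivBound (e : StarExp A) {α : Option A} {n : ℕ} {E' : StackedExp A}
    (h : Step e.toStacked α n E') : E' ∈ derivBound e := by
  induction e generalizing α n E' with
  | zero => cases h
  | one => cases h
  | act a =>
    cases h
    exact rfl
  | add e₁ e₂ h₁ h₂ =>
    cases h with
    | add_left _ _ _ _ _ h => exact Or.inl (h₁ h)
    | add_right _ _ _ _ _ h => exact Or.inr (h₂ h)
  | mul e₁ e₂ h₁ h₂ =>
    cases h with
    | mul_left _ _ _ _ _ h => exact Or.inl ⟨_, h₁ h, rfl⟩
    | mul_right _ _ _ _ _ _ h => exact Or.inr (h₂ h)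
  | star e ih =>
    cases h with
    | star_entry _ _ _ _ h => exact Or.inl ⟨_, ih h, rfl⟩
    | star_body _ _ _ _ h => exact Or.inl ⟨_, ih h, rfl⟩

theorem Step.mem_derivBound_of_mem (e : StarExp A) {E : StackedExp A} {α : Option A} {n : ℕ}
    {E' : StackedExp A} (hE : E ∈ derivBound e) (h : Step E α n E') : E' ∈ derivBound e := by
  induction e generalizing E α n E' with
  | zero => exact hE.elim
  | one => exact hE.elim
  | act a =>
    cases (hE : E = one)
    cases h
  | add e₁ e₂ h₁ h₂ => exact hE.elim (fun k => Or.inl (h₁ k h)) (fun k => Or.inr (h₂ k h))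
  | mul e₁ e₂ h₁ h₂ =>
    rcases hE with ⟨X, hX, rfl⟩ | hE
    · cases h with
      | mul_left _ _ _ _ _ h => exact Or.inl ⟨_, h₁ hX h, rfl⟩
      | mul_right _ _ _ _ _ _ h => exact Or.inr (Step.mem_derivBound e₂ h)
    · exact Or.inr (h₂ hE h)
  | star e ih =>
    rcases hE with ⟨X, hX, rfl⟩ | hE
    · cases h with
      | stack_left _ _ _ _ _ h => exact Or.inl ⟨_, ih hX h, rfl⟩
      | stack_right _ _ _ => exact Or.inr rfl
    · cases (hE : E = star e)
      exact Step.mem_derivBound (StarExp.star e) h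

theorem isVertexOf_finite (e : StarExp A) : {E : StackedExp A | IsVertexOf e E}.Finite := by
  refine ((derivBound_finite e).insert e.toStacked).subset fun E hE => ?_
  induction (hE : Relation.ReflTransGen Arrow e.toStacked E) with
  | refl => exact Or.inl rfl
  | tail _ h ih =>
    obtain ⟨α, n, h⟩ := h
    rcases ih with rfl | ih
    · exact Or.inr (Step.mem_derivBound e h)
    · exact Or.inr (Step.mem_derivBound_of_mem e ih h)

end StackedExp

namespace StarExp

variable {A : Type u}

/-- The 1-chart interpretation of a star expression. -/
def oneChart (e : StarExp A) : OneChart A where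
  V := {E : StackedExp A // StackedExp.IsVertexOf e E}
  finite_V := (StackedExp.isVertexOf_finite e).to_subtype
  start := ⟨e.toStacked, Relation.ReflTransGen.refl⟩
  Trans E α E' := ∃ n, StackedExp.Step E.1 α n E'.1
  Term E := E.1.Terminates

/-- The entry/body-labeling of the 1-chart interpretation of a star expression. -/
def entryBodyLabeling (e : StarExp A) : e.oneChart.V → Option A → ℕ → e.oneChart.V → Prop :=
  fun E α n E' => StackedExp.Step E.1 α n E'.1

end StarExp

/-! Vertices. A transition of `f* · g` either performs a step of `f` under `(_ ⋆ f*) · g` or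
performs a step of `g`. From `(F ⋆ f*) · g` one can only move inside `F` or, if `F` terminates,
return to `f* · g` by a 1-transition. Reading this off along paths gives part 1
(`isVertexOf_star_mul_iff`).

LLEE-witness. This holds for every star expression. The body transitions are well-founded on all
stacked expressions (`wellFounded_bodyStep`): an iteration `e*` can be re-entered only if the body
of `e` reaches termination, and in that case the transitions from `e*` are marked as entries, not as
body. Since 1-transitions are always body transitions, this also gives weak guardedness. A positive
label `n` arises only at a vertex `c(e*)`, with `c` an evaluation frame and `n` the star height of
`e*`. The loop generated there stays inside `c(X ⋆ e*)` with `X` a derivative of `e`, where all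
labels are smaller than `n`. After removal of the smaller positive labels only body transitions are
left inside, so every path must return.

Equations. Modulo provable equality, star expressions form a join-semilattice with bottom on which
right multiplication preserves finite joins, so the sums in the definition of a provable solution
become least upper bounds of sets of summands. Structural induction shows that `π` is a provable
solution (`solves_proj`). This settles the right-hand sides and the left-hand sides on derivatives
of `g`. At `(F ⋆ f*) · g`, multiplying the equation for `π(F)` from the right by `e` gives the
equation for `π(F) · e`; the summand `1 · e`, present when `F` terminates, is the 1-transition back.
At `f* · g` the axiom `e = f · e + g` is expanded by the equations for `f` and `g`; since `f` does
not terminate, no extra summand `1 · e` arises. -/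

namespace StarExp

variable {A : Type u}

/-! ### Normedness of star expressions -/

/-- A structural description of the star expressions that can reach termination. -/
def Normed : StarExp A → Prop
  | zero => False
  | one => True
  | act _ => True
  | add e₁ e₂ => e₁.Normed ∨ e₂.Normed
  | mul e₁ e₂ => e₁.Normed ∧ e₂.Normed
  | star _ => True

/-- A structural description of `NormedPlus`. -/
def StepNormed : StarExp A → Prop
  | zero => False
  | one => False
  | act _ => True
  | add e₁ e₂ => e₁.StepNormed ∨ e₂.StepNormed
  | mul e₁ e₂ => (e₁.StepNormed ∧ e₂.Normed) ∨ (e₁.Terminates ∧ e₂.StepNormed)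
  | star e => e.StepNormed

theorem Terminates.normed {e : StarExp A} (h : e.Terminates) : e.Normed := by
  induction h with
  | one => trivial
  | add_left _ _ _ ih => exact Or.inl ih
  | add_right _ _ _ ih => exact Or.inr ih
  | mul _ _ _ _ ih₁ ih₂ => exact ⟨ih₁, ih₂⟩
  | star => trivial

theorem StepNormed.normed {e : StarExp A} (h : e.StepNormed) : e.Normed := by
  induction e with
  | zero => exact h
  | one => trivial
  | act => trivial
  | add _ _ ih₁ ih₂ => exact h.imp ih₁ ih₂
  | mul _ _ ih₁ ih₂ => exact h.elim (fun h => ⟨ih₁ h.1, h.2⟩) (fun h => ⟨h.1.normed, ih₂ h.2⟩)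
  | star => trivial

theorem Step.stepNormed {e e' : StarExp A} {a : A} (h : Step e a e') (h' : e'.Normed) :
    e.StepNormed := by
  induction h with
  | act => trivial
  | add_left _ _ _ _ _ ih => exact Or.inl (ih h')
  | add_right _ _ _ _ _ ih => exact Or.inr (ih h')
  | mul_left _ _ _ _ _ ih => exact Or.inl ⟨ih h'.1, h'.2⟩
  | mul_right _ _ _ _ h₁ _ ih => exact Or.inr ⟨h₁, ih h'⟩
  | star _ _ _ _ ih => exact ih h'.1

theorem NormedPlus.stepNormed {e : StarExp A} (h : e.NormedPlus) : e.StepNormed := by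
  obtain ⟨f, h, hf⟩ := h
  induction h using Relation.TransGen.head_induction_on with
  | single h =>
    obtain ⟨a, h⟩ := h
    exact h.stepNormed hf.normed
  | head h _ ih =>
    obtain ⟨a, h⟩ := h
    exact h.stepNormed ih.normed

theorem NormedPlus.of_forall_step {e e' : StarExp A} (h : e.NormedPlus)
    (hs : ∀ a x, Step e a x → Step e' a x) : e'.NormedPlus := by
  obtain ⟨f, h, hf⟩ := h
  obtain ⟨x, ⟨a, hx⟩, hxf⟩ := Relation.TransGen.head'_iff.1 h
  exact ⟨f, Relation.TransGen.head' ⟨a, hs a x hx⟩ hxf, hf⟩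

theorem NormedPlus.mul {e₁ e₂ : StarExp A} (h₁ : e₁.NormedPlus)
    (h₂ : e₂.Terminates ∨ e₂.NormedPlus) : (mul e₁ e₂).NormedPlus := by
  obtain ⟨f, h, hf⟩ := h₁
  have hm : Relation.TransGen (fun x y => ∃ a, Step x a y) (StarExp.mul e₁ e₂)
      (StarExp.mul f e₂) :=
    Relation.TransGen.lift (fun x => StarExp.mul x e₂)
      (fun _ _ ⟨a, h⟩ => ⟨a, Step.mul_left _ _ _ _ h⟩) _ _ h
  rcases h₂ with h₂ | h₂
  · exact ⟨_, hm, Terminates.mul _ _ hf h₂⟩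
  · obtain ⟨k, hk, hkt⟩ := h₂.of_forall_step (e' := StarExp.mul f e₂)
      fun a x h => Step.mul_right _ _ _ _ hf h
    exact ⟨k, hm.trans hk, hkt⟩

theorem normedPlus_of_normed (e : StarExp A) :
    (e.Normed → e.Terminates ∨ e.NormedPlus) ∧ (e.StepNormed → e.NormedPlus) := by
  induction e with
  | zero => exact ⟨False.elim, False.elim⟩
  | one => exact ⟨fun _ => Or.inl Terminates.one, False.elim⟩
  | act a =>
    have h : (act a).NormedPlus := ⟨one, Relation.TransGen.single ⟨a, Step.act a⟩, Terminates.one⟩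
    exact ⟨fun _ => Or.inr h, fun _ => h⟩
  | add e₁ e₂ ih₁ ih₂ =>
    have l₁ : e₁.NormedPlus → (add e₁ e₂).NormedPlus := fun h =>
      h.of_forall_step fun a x => Step.add_left _ _ a x
    have l₂ : e₂.NormedPlus → (add e₁ e₂).NormedPlus := fun h =>
      h.of_forall_step fun a x => Step.add_right _ _ a x
    refine ⟨fun h => ?_, fun h => h.elim (fun h => l₁ (ih₁.2 h)) (fun h => l₂ (ih₂.2 h))⟩
    rcases h with h | h
    · exact (ih₁.1 h).imp (Terminates.add_left _ _) l₁
    · exact (ih₂.1 h).imp (Terminates.add_right _ _) l₂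
  | mul e₁ e₂ ih₁ ih₂ =>
    have l₂ : e₁.Terminates → e₂.NormedPlus → (mul e₁ e₂).NormedPlus := fun h₁ h =>
      h.of_forall_step fun a x => Step.mul_right _ _ a x h₁
    refine ⟨fun h => ?_, fun h => ?_⟩
    · rcases ih₁.1 h.1 with h₁ | h₁
      · exact (ih₂.1 h.2).imp (Terminates.mul _ _ h₁) (l₂ h₁)
      · exact Or.inr (h₁.mul (ih₂.1 h.2))
    · rcases h with h | h
      · exact (ih₁.2 h.1).mul (ih₂.1 h.2)
      · exact l₂ h.1 (ih₂.2 h.2)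
  | star e ih =>
    refine ⟨fun _ => Or.inl (Terminates.star e), fun h => ?_⟩
    obtain ⟨f, h, hf⟩ := ih.2 h
    obtain ⟨x, ⟨a, hx⟩, hxf⟩ := Relation.TransGen.head'_iff.1 h
    exact ⟨mul f (star e), Relation.TransGen.head' ⟨a, Step.star _ _ _ hx⟩
      (Relation.ReflTransGen.lift (fun x => mul x (star e))
        (fun _ _ ⟨a, h⟩ => ⟨a, Step.mul_left _ _ _ _ h⟩) _ _ hxf),
      Terminates.mul _ _ hf (Terminates.star e)⟩

/-- The side condition on entry transitions refers to the unstacked transition system. The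
structural predicate can be compared with stacked transitions too, and so links the two systems. -/
theorem normedPlus_iff {e : StarExp A} : e.NormedPlus ↔ e.StepNormed :=
  ⟨NormedPlus.stepNormed, (normedPlus_of_normed e).2⟩

/-! ### Embedding into stacked star expressions -/

theorem proj_toStacked (e : StarExp A) : e.toStacked.proj = e := by
  induction e with
  | mul _ _ ih _ => exact congrArg (mul · _) ih
  | _ => rfl

theorem toStacked_injective : Function.Injective (toStacked (A := A)) :=
  Function.LeftInverse.injective proj_toStacked

end StarExp

namespace StackedExp

variable {A : Type u}

theorem terminates_toStacked {e : StarExp A} : Terminates e.toStacked ↔ e.Terminates :=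
  ⟨fun ⟨_, h, h'⟩ => StarExp.toStacked_injective h ▸ h', fun h => ⟨e, rfl, h⟩⟩

theorem Terminates.proj {E : StackedExp A} (h : E.Terminates) : E.proj.Terminates := by
  obtain ⟨e, rfl, h⟩ := h
  rwa [StarExp.proj_toStacked]

theorem terminates_one : Terminates (one : StackedExp A) :=
  terminates_toStacked.2 StarExp.Terminates.one

theorem terminates_star (e : StarExp A) : Terminates (star e) :=
  terminates_toStacked.2 (StarExp.Terminates.star e)

theorem not_terminates_zero : ¬ Terminates (zero : StackedExp A) := fun h => by
  cases h.proj

theorem not_terminates_act (a : A) : ¬ Terminates (act a) := fun h => by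
  cases h.proj

theorem not_terminates_stack (E : StackedExp A) (e : StarExp A) : ¬ Terminates (stack E e) := by
  rintro ⟨x, h, -⟩
  cases x <;> cases h

theorem terminates_add {e₁ e₂ : StarExp A} :
    Terminates (add e₁ e₂) ↔ e₁.Terminates ∨ e₂.Terminates := by
  refine (terminates_toStacked (e := StarExp.add e₁ e₂)).trans ⟨fun h => ?_, fun h => ?_⟩
  · cases h with
    | add_left _ _ h => exact Or.inl h
    | add_right _ _ h => exact Or.inr h
  · exact h.elim (StarExp.Terminates.add_left _ _) (StarExp.Terminates.add_right _ _)

theorem terminates_mul {E : StackedExp A} {e : StarExp A} :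
    Terminates (mul E e) ↔ E.Terminates ∧ e.Terminates := by
  constructor
  · rintro ⟨x, h, hx⟩
    cases hx with
    | mul x y hx hy =>
      cases h
      exact ⟨⟨_, rfl, hx⟩, hy⟩
    | _ => cases h
  · rintro ⟨⟨x, rfl, hx⟩, he⟩
    exact ⟨StarExp.mul x e, rfl, StarExp.Terminates.mul _ _ hx he⟩

/-! ### Elementary properties of marked transitions -/

theorem Step.exists_eq_some {e : StarExp A} {α : Option A} {n : ℕ} {E' : StackedExp A}
    (h : Step e.toStacked α n E') : ∃ a, α = some a := by
  induction e generalizing α n E' with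
  | zero => cases h
  | one => cases h
  | mul _ _ ih _ =>
    cases h with
    | mul_left _ _ _ _ _ h => exact ih h
    | mul_right => exact ⟨_, rfl⟩
  | _ => cases h <;> exact ⟨_, rfl⟩

theorem Step.marking_eq_zero {E E' : StackedExp A} {α : Option A} {n : ℕ} (h : Step E α n E')
    (hα : α = none) : n = 0 := by
  induction h with
  | mul_left _ _ _ _ _ _ ih => exact ih hα
  | stack_left _ _ _ _ _ _ ih => exact ih hα
  | stack_right => rfl
  | _ => cases hα

/-- Derivation changes only left factors, so the right factor of a product that is a derivative of
`e` is already the right factor of a product subterm of `e`. Hence `X · e` is never a derivative of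
`e`, which keeps the two kinds of transitions from a product apart, and keeps derivatives of `g`
apart from the other vertices of `f* · g`. -/
theorem sizeOf_lt_of_mul_mem_derivBound {e x : StarExp A} {E : StackedExp A}
    (h : mul E x ∈ derivBound e) : sizeOf x < sizeOf e := by
  induction e with
  | zero => exact h.elim
  | one => exact h.elim
  | act a => cases (h : mul E x = one)
  | add _ _ ih₁ ih₂ =>
    rcases h with h | h
    · have := ih₁ h
      simp only [StarExp.add.sizeOf_spec]
      omega
    · have := ih₂ h
      simp only [StarExp.add.sizeOf_spec]
      omega
  | mul _ _ _ ih₂ =>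
    rcases h with ⟨_, _, h⟩ | h
    · cases h
      simp only [StarExp.mul.sizeOf_spec]
      omega
    · have := ih₂ h
      simp only [StarExp.mul.sizeOf_spec]
      omega
  | star e _ =>
    rcases h with ⟨_, _, h⟩ | h
    · cases h
    · cases (h : mul E x = star e)

theorem IsIteratedDerivative.mem_derivBound {e : StarExp A} {E : StackedExp A}
    (h : IsIteratedDerivative e E) : E ∈ derivBound e := by
  induction (h : Relation.TransGen Arrow e.toStacked E) with
  | single h =>
    obtain ⟨_, _, h⟩ := h
    exact Step.mem_derivBound e h
  | tail _ h ih =>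
    obtain ⟨_, _, h⟩ := h
    exact Step.mem_derivBound_of_mem e ih h

theorem mul_not_mem_derivBound (e : StarExp A) (E : StackedExp A) : mul E e ∉ derivBound e :=
  fun h => lt_irrefl _ (sizeOf_lt_of_mul_mem_derivBound h)

theorem Step.marking_unique {E E' : StackedExp A} {α : Option A} {m n : ℕ}
    (hm : Step E α m E') (hn : Step E α n E') : m = n := by
  induction hm generalizing n with
  | act => cases hn; rfl
  | add_left => cases hn <;> rfl
  | add_right => cases hn <;> rfl
  | star_entry _ _ _ _ _ h =>
    cases hn with
    | star_entry => rfl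
    | star_body _ _ _ _ _ h' => exact absurd h h'
  | star_body _ _ _ _ _ h =>
    cases hn with
    | star_entry _ _ _ _ _ h' => exact absurd h' h
    | star_body => rfl
  | mul_left _ e _ _ _ _ ih =>
    cases hn with
    | mul_left _ _ _ _ _ h => exact ih h
    -- The two product rules never share a target: this one would make a product with right factor
    -- `e` a derivative of `e`.
    | mul_right _ _ _ _ _ _ h => exact absurd (h.mem_derivBound) (mul_not_mem_derivBound e _)
  | stack_left _ _ _ _ _ _ ih =>
    cases hn with
    | stack_left _ _ _ _ _ h => exact ih h
  | mul_right _ e _ _ _ _ h =>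
    cases hn with
    | mul_left => exact absurd (h.mem_derivBound) (mul_not_mem_derivBound e _)
    | mul_right => rfl
  | stack_right =>
    cases hn with
    | stack_right => rfl

theorem Step.marking_le_starHeight {e : StarExp A} {E' : StackedExp A} {α : Option A} {n : ℕ}
    (h : Step e.toStacked α n E') : n ≤ e.starHeight := by
  induction e generalizing α n E' with
  | zero => cases h
  | one => cases h
  | mul _ _ ih _ =>
    cases h with
    | mul_left _ _ _ _ _ h => exact (ih h).trans (le_max_left _ _)
    | mul_right => exact Nat.zero_le _
  | _ => cases h <;> first | exact Nat.zero_le _ | exact le_rfl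

theorem Step.marking_le_starHeight_of_mem {e : StarExp A} {E E' : StackedExp A} {α : Option A}
    {n : ℕ} (hE : E ∈ derivBound e) (h : Step E α n E') : n ≤ e.starHeight := by
  induction e generalizing E α n E' with
  | zero => exact hE.elim
  | one => exact hE.elim
  | act a =>
    cases (hE : E = one)
    cases h
  | add _ _ ih₁ ih₂ =>
    rcases hE with hE | hE
    · exact (ih₁ hE h).trans (le_max_left _ _)
    · exact (ih₂ hE h).trans (le_max_right _ _)
  | mul _ _ ih₁ ih₂ =>
    rcases hE with ⟨_, hE, rfl⟩ | hE
    · cases h with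
      | mul_left _ _ _ _ _ h => exact (ih₁ hE h).trans (le_max_left _ _)
      | mul_right => exact Nat.zero_le _
    · exact (ih₂ hE h).trans (le_max_right _ _)
  | star e ih =>
    rcases hE with ⟨_, hE, rfl⟩ | hE
    · cases h with
      | stack_left _ _ _ _ _ h => exact (ih hE h).trans (Nat.le_add_left _ _)
      | stack_right => exact Nat.zero_le _
    · cases (hE : E = star e)
      exact Step.marking_le_starHeight (e := StarExp.star e) h

/-! ### Body transitions -/

/-- There is a transition with marking label `0` from `E` to `E'`. -/
def BodyStep (E E' : StackedExp A) : Prop := ∃ α, Step E α 0 E'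

/-- Normedness propagates backwards along transitions. The sharper claim for unstacked sources is
carried along because the premises of several rules start from a star expression. -/
theorem Step.normed_proj {E E' : StackedExp A} {α : Option A} {n : ℕ} (h : Step E α n E') :
    (E'.proj.Normed → E.proj.Normed) ∧
      ∀ e : StarExp A, E = e.toStacked → E'.proj.Normed → e.StepNormed := by
  induction h with
  | act a =>
    refine ⟨fun _ => trivial, ?_⟩
    rintro e he -
    cases StarExp.toStacked_injective (a₁ := StarExp.act a) he
    trivial
  | add_left e₁ e₂ _ _ _ _ ih =>
    refine ⟨fun h => Or.inl (ih.2 _ rfl h).normed, ?_⟩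
    rintro e he h
    cases StarExp.toStacked_injective (a₁ := StarExp.add e₁ e₂) he
    exact Or.inl (ih.2 _ rfl h)
  | add_right e₁ e₂ _ _ _ _ ih =>
    refine ⟨fun h => Or.inr (ih.2 _ rfl h).normed, ?_⟩
    rintro e he h
    cases StarExp.toStacked_injective (a₁ := StarExp.add e₁ e₂) he
    exact Or.inr (ih.2 _ rfl h)
  | star_entry x _ _ _ _ _ ih =>
    refine ⟨fun h => trivial, ?_⟩
    rintro e he h
    cases StarExp.toStacked_injective (a₁ := StarExp.star x) he
    exact (ih.2 x rfl h.1 : x.StepNormed)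
  | star_body x _ _ _ _ _ ih =>
    refine ⟨fun h => trivial, ?_⟩
    rintro e he h
    cases StarExp.toStacked_injective (a₁ := StarExp.star x) he
    exact (ih.2 x rfl h.1 : x.StepNormed)
  | mul_left E x _ _ _ _ ih =>
    refine ⟨fun h => ⟨ih.1 h.1, h.2⟩, ?_⟩
    rintro e he h
    cases e <;> cases he
    exact Or.inl ⟨ih.2 _ rfl h.1, h.2⟩
  | stack_left E x _ _ _ _ ih =>
    refine ⟨fun h => ⟨ih.1 h.1, h.2⟩, ?_⟩
    rintro e he
    cases e <;> cases he
  | mul_right E x _ _ _ hE _ ih =>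
    refine ⟨fun h => ⟨hE.proj.normed, (ih.2 _ rfl h).normed⟩, ?_⟩
    rintro e he h
    cases e <;> cases he
    exact Or.inr ⟨terminates_toStacked.1 hE, ih.2 _ rfl h⟩
  | stack_right E x hE =>
    refine ⟨fun h => ⟨hE.proj.normed, trivial⟩, ?_⟩
    rintro e he
    cases e <;> cases he

theorem acc_mul {E : StackedExp A} {e : StarExp A}
    (hE : Acc (fun y x => BodyStep x y) E)
    (he : ∀ α n E', Step e.toStacked α n E' → Acc (fun y x => BodyStep x y) E') :
    Acc (fun y x => BodyStep x y) (mul E e) := by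
  induction hE with
  | intro E _ ih =>
    refine Acc.intro _ fun E' h => ?_
    obtain ⟨α, h⟩ := h
    cases h with
    | mul_left _ _ _ _ _ h => exact ih _ ⟨_, h⟩
    | mul_right _ _ _ _ _ _ h => exact he _ _ _ h

/-- The only exit from the stacked product leads to `e*` and needs a terminating left part.
Accessibility of `e*` is therefore required only when `E` is normed, a condition that can be
vacuous. -/
theorem acc_stack {E : StackedExp A} {e : StarExp A}
    (hE : Acc (fun y x => BodyStep x y) E)
    (he : E.proj.Normed → Acc (fun y x => BodyStep x y) (star e)) :
    Acc (fun y x => BodyStep x y) (stack E e) := by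
  induction hE with
  | intro E _ ih =>
    refine Acc.intro _ fun E' h => ?_
    obtain ⟨α, h⟩ := h
    cases h with
    | stack_left _ _ _ _ _ h => exact ih _ ⟨_, h⟩ fun h' => he (h.normed_proj.1 h')
    | stack_right _ _ hE => exact he hE.proj.normed

theorem acc_of_step (e : StarExp A) {α : Option A} {n : ℕ} {E' : StackedExp A}
    (h : Step e.toStacked α n E') : Acc (fun y x => BodyStep x y) E' := by
  induction e generalizing α n E' with
  | zero => cases h
  | one => cases h
  | act =>
    cases h
    exact Acc.intro _ fun _ ⟨_, h⟩ => by cases h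
  | add _ _ ih₁ ih₂ =>
    cases h with
    | add_left _ _ _ _ _ h => exact ih₁ h
    | add_right _ _ _ _ _ h => exact ih₂ h
  | mul _ _ ih₁ ih₂ =>
    cases h with
    | mul_left _ _ _ _ _ h => exact acc_mul (ih₁ h) fun _ _ _ => ih₂
    | mul_right _ _ _ _ _ _ h => exact ih₂ h
  | star e ih =>
    cases h with
    | star_entry _ _ _ _ h hn =>
      -- All transitions from `e*` are entries here, and their label, a star height, is positive. So
      -- `e*` has no body successor.
      refine acc_stack (ih h) fun _ => Acc.intro _ fun _ ⟨_, h'⟩ => ?_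
      generalize hm : 0 = m at h'
      cases h' with
      | star_entry => exact absurd hm (by simp [StarExp.starHeight]; omega)
      | star_body _ _ _ _ _ h' => exact absurd hn h'
    | star_body _ _ _ _ h hn =>
      -- If the left part were normed, `e` would reach termination in a positive number of steps. So
      -- `e*` is never reached again.
      exact acc_stack (ih h) fun h' =>
        absurd (StarExp.normedPlus_iff.2 (h.normed_proj.2 e rfl h')) hn

theorem acc_toStacked (e : StarExp A) : Acc (fun y x => BodyStep x y) e.toStacked :=
  Acc.intro _ fun _ ⟨_, h⟩ => acc_of_step e h

theorem wellFounded_bodyStep : WellFounded (fun y x : StackedExp A => BodyStep x y) := by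
  refine ⟨fun E => ?_⟩
  induction E with
  | zero => exact acc_toStacked StarExp.zero
  | one => exact acc_toStacked StarExp.one
  | act a => exact acc_toStacked (StarExp.act a)
  | add e₁ e₂ => exact acc_toStacked (StarExp.add e₁ e₂)
  | mul E e ih => exact acc_mul ih fun _ _ _ => acc_of_step e
  | star e => exact acc_toStacked (StarExp.star e)
  | stack E e ih => exact acc_stack ih fun _ => acc_toStacked (StarExp.star e)

theorem not_forall_bodyStep (p : ℕ → StackedExp A) : ¬ ∀ i, BodyStep (p i) (p (i + 1)) :=
  fun h => (wellFounded_iff_isEmpty_descending_chain.1 wellFounded_bodyStep).false ⟨p, h⟩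

/-! ### Reaching termination by body transitions -/

/-- There is a path of body transitions from `E` to termination. -/
def BodyNormed (E : StackedExp A) : Prop :=
  ∃ T : StackedExp A, Relation.ReflTransGen BodyStep E T ∧ T.Terminates

/-- There is a transition from `e` that is followed by a path of body transitions to
termination. -/
def StepBodyNormed (e : StarExp A) : Prop :=
  ∃ a n E', Step e.toStacked (some a) n E' ∧ BodyNormed E'

theorem BodyNormed.mul {E : StackedExp A} {e : StarExp A} (hE : BodyNormed E)
    (he : e.Terminates ∨ StepBodyNormed e) : BodyNormed (mul E e) := by
  obtain ⟨T, hT, hT'⟩ := hE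
  have h : Relation.ReflTransGen BodyStep (StackedExp.mul E e) (StackedExp.mul T e) :=
    Relation.ReflTransGen.lift (fun X => StackedExp.mul X e)
      (fun _ _ ⟨α, h⟩ => ⟨α, Step.mul_left _ _ _ _ _ h⟩) _ _ hT
  rcases he with he | ⟨a, n, E', hs, U, hU, hU'⟩
  · exact ⟨_, h, terminates_mul.2 ⟨hT', he⟩⟩
  · exact ⟨U, h.trans (Relation.ReflTransGen.head ⟨_, Step.mul_right _ _ _ _ _ hT' hs⟩ hU), hU'⟩

theorem BodyNormed.stack {E : StackedExp A} (hE : BodyNormed E) (e : StarExp A) :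
    Relation.ReflTransGen BodyStep (stack E e) (star e) := by
  obtain ⟨T, hT, hT'⟩ := hE
  have h : Relation.ReflTransGen BodyStep (StackedExp.stack E e) (StackedExp.stack T e) :=
    Relation.ReflTransGen.lift (fun X => StackedExp.stack X e)
      (fun _ _ ⟨α, h⟩ => ⟨α, Step.stack_left _ _ _ _ _ h⟩) _ _ hT
  exact h.tail ⟨_, Step.stack_right _ _ hT'⟩

theorem stepBodyNormed_star {e : StarExp A} (h : StepBodyNormed e) :
    StepBodyNormed (StarExp.star e) := by
  obtain ⟨a, n, E', hs, hE'⟩ := h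
  have hb : BodyNormed (StackedExp.stack E' e) := ⟨_, hE'.stack e, terminates_star e⟩
  by_cases hn : e.NormedPlus
  · exact ⟨a, _, _, Step.star_entry _ _ _ _ hs hn, hb⟩
  · exact ⟨a, _, _, Step.star_body _ _ _ _ hs hn, hb⟩

/-- Termination can be reached with at most the first transition marked as an entry. After one entry
into an iteration, body transitions lead back to `e*`, which terminates; and the first transition of
a right factor gets label `0` from the product rule. This supplies the way back in every loop. -/
theorem stepBodyNormed_of_stepNormed (e : StarExp A) :
    (e.Normed → e.Terminates ∨ StepBodyNormed e) ∧ (e.StepNormed → StepBodyNormed e) := by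
  induction e with
  | zero => exact ⟨False.elim, False.elim⟩
  | one => exact ⟨fun _ => Or.inl StarExp.Terminates.one, False.elim⟩
  | act a =>
    have h : StepBodyNormed (StarExp.act a) :=
      ⟨a, 0, one, Step.act a, one, Relation.ReflTransGen.refl, terminates_one⟩
    exact ⟨fun _ => Or.inr h, fun _ => h⟩
  | add e₁ e₂ ih₁ ih₂ =>
    have l₁ : StepBodyNormed e₁ → StepBodyNormed (StarExp.add e₁ e₂) :=
      fun ⟨a, _, E', h, h'⟩ => ⟨a, 0, E', Step.add_left _ _ _ _ _ h, h'⟩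
    have l₂ : StepBodyNormed e₂ → StepBodyNormed (StarExp.add e₁ e₂) :=
      fun ⟨a, _, E', h, h'⟩ => ⟨a, 0, E', Step.add_right _ _ _ _ _ h, h'⟩
    refine ⟨fun h => ?_, fun h => h.elim (fun h => l₁ (ih₁.2 h)) (fun h => l₂ (ih₂.2 h))⟩
    rcases h with h | h
    · exact (ih₁.1 h).imp (StarExp.Terminates.add_left _ _) l₁
    · exact (ih₂.1 h).imp (StarExp.Terminates.add_right _ _) l₂
  | mul e₁ e₂ ih₁ ih₂ =>
    have l₁ : StepBodyNormed e₁ → e₂.Normed → StepBodyNormed (StarExp.mul e₁ e₂) :=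
      fun ⟨a, n, E', h, h'⟩ h₂ =>
        ⟨a, n, _, Step.mul_left _ _ _ _ _ h, h'.mul (ih₂.1 h₂)⟩
    have l₂ : e₁.Terminates → StepBodyNormed e₂ → StepBodyNormed (StarExp.mul e₁ e₂) :=
      fun h₁ ⟨a, _, E', h, h'⟩ =>
        ⟨a, 0, E', Step.mul_right _ _ _ _ _ (terminates_toStacked.2 h₁) h, h'⟩
    refine ⟨fun h => ?_, fun h => h.elim (fun h => l₁ (ih₁.2 h.1) h.2)
      (fun h => l₂ h.1 (ih₂.2 h.2))⟩
    rcases ih₁.1 h.1 with h₁ | h₁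
    · exact (ih₂.1 h.2).imp (StarExp.Terminates.mul _ _ h₁) (l₂ h₁)
    · exact Or.inr (l₁ h₁ h.2)
  | star e ih =>
    exact ⟨fun _ => Or.inl (StarExp.Terminates.star e), fun h => stepBodyNormed_star (ih.2 h)⟩

/-! ### Loops -/

/-- Evaluation contexts of stacked star expressions. -/
inductive IsFrame : (StackedExp A → StackedExp A) → Prop
  | hole : IsFrame id
  | mul (c : StackedExp A → StackedExp A) (e : StarExp A) :
      IsFrame c → IsFrame fun X => StackedExp.mul (c X) e
  | stack (c : StackedExp A → StackedExp A) (e : StarExp A) :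
      IsFrame c → IsFrame fun X => StackedExp.stack (c X) e

theorem IsFrame.injective {c : StackedExp A → StackedExp A} (hc : IsFrame c) :
    Function.Injective c := by
  induction hc with
  | hole => exact Function.injective_id
  | mul _ _ _ ih =>
    intro X Y h
    injection h with h
    exact ih h
  | stack _ _ _ ih =>
    intro X Y h
    injection h with h
    exact ih h

theorem IsFrame.step {c : StackedExp A → StackedExp A} (hc : IsFrame c) {E E' : StackedExp A}
    {α : Option A} {n : ℕ} (h : Step E α n E') : Step (c E) α n (c E') := by
  induction hc with
  | hole => exact h
  | mul _ _ _ ih => exact Step.mul_left _ _ _ _ _ ih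
  | stack _ _ _ ih => exact Step.stack_left _ _ _ _ _ ih

theorem IsFrame.not_terminates {c : StackedExp A → StackedExp A} (hc : IsFrame c)
    {E : StackedExp A} (hE : ¬ E.Terminates) : ¬ (c E).Terminates := by
  induction hc with
  | hole => exact hE
  | mul _ _ _ ih => exact fun h => ih (terminates_mul.1 h).1
  | stack _ _ _ ih => exact not_terminates_stack _ _

/-- A transition that does not come from inside the frame needs a terminating expression in the left
position and carries label `0`. Either alternative in `hE` excludes this. -/
theorem IsFrame.exists_step {c : StackedExp A → StackedExp A} (hc : IsFrame c)
    {E E' : StackedExp A} {α : Option A} {n : ℕ} (hE : ¬ E.Terminates ∨ 0 < n)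
    (h : Step (c E) α n E') : ∃ X, E' = c X ∧ Step E α n X := by
  induction hc generalizing E' with
  | hole => exact ⟨E', rfl, h⟩
  | mul c _ hc ih =>
    cases h with
    | mul_left _ _ _ _ _ h =>
      obtain ⟨X, rfl, hX⟩ := ih h
      exact ⟨X, rfl, hX⟩
    | mul_right _ _ _ _ _ h =>
      exact hE.elim (fun hE => absurd h (hc.not_terminates hE)) (fun h => absurd h (lt_irrefl 0))
  | stack c _ hc ih =>
    cases h with
    | stack_left _ _ _ _ _ h =>
      obtain ⟨X, rfl, hX⟩ := ih h
      exact ⟨X, rfl, hX⟩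
    | stack_right _ _ h =>
      exact hE.elim (fun hE => absurd h (hc.not_terminates hE)) (fun h => absurd h (lt_irrefl 0))

theorem Step.exists_frame {E E' : StackedExp A} {α : Option A} {n : ℕ} (h : Step E α n E')
    (hn : 0 < n) : ∃ c e, IsFrame c ∧ E = c (star e) ∧ e.NormedPlus ∧
      n = (StarExp.star e).starHeight := by
  induction h with
  | star_entry e _ _ _ _ h => exact ⟨id, e, IsFrame.hole, rfl, h, rfl⟩
  | mul_left _ _ _ _ _ _ ih =>
    obtain ⟨c, e, hc, rfl, h⟩ := ih hn
    exact ⟨_, e, IsFrame.mul c _ hc, rfl, h⟩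
  | stack_left _ _ _ _ _ _ ih =>
    obtain ⟨c, e, hc, rfl, h⟩ := ih hn
    exact ⟨_, e, IsFrame.stack c _ hc, rfl, h⟩
  | _ => exact absurd hn (lt_irrefl 0)

theorem Step.of_star {e : StarExp A} {α : Option A} {n : ℕ} {E' : StackedExp A}
    (h : Step (star e) α n E') :
    ∃ a m X, α = some a ∧ E' = stack X e ∧ Step e.toStacked (some a) m X := by
  cases h with
  | star_entry _ _ _ _ h => exact ⟨_, _, _, rfl, rfl, h⟩
  | star_body _ _ _ _ h => exact ⟨_, _, _, rfl, rfl, h⟩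

end StackedExp

/-! ### Infinite paths, the LLEE-witness, and weak guardedness -/

theorem Relation.TransGen.exists_infinite_path {β : Type*} {r : β → β → Prop} {a : β}
    (h : Relation.TransGen r a a) : ∃ p : ℕ → β, p 0 = a ∧ ∀ i, r (p i) (p (i + 1)) := by
  -- Every point that can reach `a` has a successor that can reach `a`; iterating a choice of such
  -- successors gives the path.
  have key : ∀ y : {y // Relation.ReflTransGen r y a},
      ∃ z : {y // Relation.ReflTransGen r y a}, r y.1 z.1 := by
    rintro ⟨y, hy⟩
    rcases Relation.ReflTransGen.cases_head hy with rfl | ⟨z, hz, hza⟩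
    · obtain ⟨z, hz, hza⟩ := Relation.TransGen.head'_iff.1 h
      exact ⟨⟨z, hza⟩, hz⟩
    · exact ⟨⟨z, hza⟩, hz⟩
  choose f hf using key
  refine ⟨fun i => (f^[i] ⟨a, Relation.ReflTransGen.refl⟩).1, rfl, fun i => ?_⟩
  simp only [Function.iterate_succ_apply']
  exact hf _

namespace StackedExp

variable {A : Type u}

theorem isLLEEWitness_entryBodyLabeling (x : StarExp A) :
    x.oneChart.IsLLEEWitness x.entryBodyLabeling := by
  refine ⟨⟨fun _ _ _ => Iff.rfl, fun _ _ _ _ _ hm hn => Step.marking_unique hm hn⟩,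
    ?_, ?_⟩
  · rintro n v hn ⟨α, w, h⟩
    obtain ⟨c, e, hc, hv, he, hne⟩ := Step.exists_frame h hn
    -- The frame stays fixed throughout the loop: stacked products do not terminate, so it can be
    -- left only after a return to `v = c(e*)`.
    have hgen : ∀ y, (x.oneChart.remaining x.entryBodyLabeling (n - 1)).GenVertex v
        (fun α w => x.entryBodyLabeling v α n w) y →
        y = v ∨ ∃ X ∈ derivBound e, y.1 = c (stack X e) := by
      intro y hy
      induction hy with
      | root => exact Or.inl rfl
      | entry α w hw =>
        obtain ⟨X, hX, hs⟩ := hc.exists_step (Or.inr hn) 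
          (hv ▸ hw : Step (c (star e)) α n w.1)
        obtain ⟨a, m, X, rfl, rfl, hs'⟩ := hs.of_star
        exact Or.inr ⟨X, Step.mem_derivBound e hs', hX⟩
      | body y α w _ hyv hw ih =>
        obtain ⟨X, hX, hy⟩ := ih.resolve_left hyv
        obtain ⟨m, hw, -⟩ := hw
        obtain ⟨Z, hZ, hs⟩ := hc.exists_step (Or.inl (not_terminates_stack X e))
          (hy ▸ hw : Step (c (stack X e)) α m w.1)
        cases hs with
        | stack_left _ _ _ _ _ hs => exact Or.inr ⟨_, Step.mem_derivBound_of_mem e hX hs, hZ⟩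
        | stack_right => exact Or.inl (Subtype.ext (hZ.trans hv.symm))
    have hmark : ∀ y, (x.oneChart.remaining x.entryBodyLabeling (n - 1)).GenVertex v
        (fun α w => x.entryBodyLabeling v α n w) y → y ≠ v →
        ∀ α m z, x.entryBodyLabeling y α m z → m < n := by
      intro y hy hyv α m z hz
      obtain ⟨X, hX, hy⟩ := (hgen y hy).resolve_left hyv
      obtain ⟨Z, hZ, hs⟩ := hc.exists_step (Or.inl (not_terminates_stack X e))
        (hy ▸ hz : Step (c (stack X e)) α m z.1)
      cases hs with
      | stack_left _ _ _ _ _ hs =>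
        have := Step.marking_le_starHeight_of_mem hX hs
        simp only [StarExp.starHeight] at hne
        omega
      | stack_right => exact hn
    refine ⟨⟨?_, ?_, ?_⟩, hmark⟩
    · obtain ⟨a, m, E', hs, hE'⟩ := (stepBodyNormed_of_stepNormed e).2 he.stepNormed
      have hs' : Step v.1 (some a) n (c (stack E' e)) := by
        rw [hv, hne]
        exact hc.step (Step.star_entry _ _ _ _ hs he)
      -- A body path to `e*`, placed in the frame, becomes a path of the generated sub-1-chart to
      -- `v`. It is cut off at its first visit to `v`, because from there the sub-1-chart has only
      -- the entry transitions.
      have hpath : ∀ Y, Relation.ReflTransGen BodyStep Y (star e) →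
          ∀ (hY : IsVertexOf x (c Y))
            (hG : (x.oneChart.remaining x.entryBodyLabeling (n - 1)).GenVertex v
              (fun α w => x.entryBodyLabeling v α n w) ⟨c Y, hY⟩),
          Relation.ReflTransGen (fun y z => ∃ α,
            ((x.oneChart.remaining x.entryBodyLabeling (n - 1)).generated v
              (fun α w => x.entryBodyLabeling v α n w)).Trans y α z) ⟨⟨c Y, hY⟩, hG⟩
            ⟨v, OneChart.GenVertex.root⟩ := by
        intro Y hY
        induction hY using Relation.ReflTransGen.head_induction_on with
        | refl =>
          intro hY hG
          have : (⟨c (star e), hY⟩ : x.oneChart.V) = v := Subtype.ext hv.symm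
          subst this
          exact Relation.ReflTransGen.refl
        | head h _ ih =>
          rename_i Y Z _
          intro hY hG
          obtain ⟨α, h⟩ := h
          by_cases hYv : (⟨c Y, hY⟩ : x.oneChart.V) = v
          · subst hYv
            exact Relation.ReflTransGen.refl
          · have hZ : IsVertexOf x (c Z) := Relation.ReflTransGen.tail hY ⟨α, 0, hc.step h⟩
            have ht : (x.oneChart.remaining x.entryBodyLabeling (n - 1)).Trans
                ⟨c Y, hY⟩ α ⟨c Z, hZ⟩ := ⟨0, hc.step h, Or.inl rfl⟩
            exact Relation.ReflTransGen.head ⟨α, Or.inr ⟨hYv, ht⟩⟩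
              (ih hZ (OneChart.GenVertex.body _ _ _ hG hYv ht))
      have hw : IsVertexOf x (c (stack E' e)) := Relation.ReflTransGen.tail v.2 ⟨_, _, hs'⟩
      obtain ⟨p, hp, hp'⟩ := Relation.TransGen.exists_infinite_path (Relation.TransGen.head'
        (r := fun y z => ∃ α, ((x.oneChart.remaining x.entryBodyLabeling (n - 1)).generated v
          (fun α w => x.entryBodyLabeling v α n w)).Trans y α z)
        (a := ⟨v, OneChart.GenVertex.root⟩) (b := ⟨⟨c (stack E' e), hw⟩, OneChart.GenVertex.entry (some a) _ hs'⟩)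
        ⟨some a, Or.inl ⟨rfl, hs'⟩⟩
        (hpath _ (hE'.stack e) hw (OneChart.GenVertex.entry (some a) _ hs')))
      exact ⟨p, hp, hp'⟩
    · intro p hp
      by_contra! hne'
      -- The shift by one drops the initial entry transition from `v`; on a path that never returns,
      -- all later transitions are body transitions.
      refine not_forall_bodyStep (fun i => (p (i + 1)).1.1) fun i => ?_
      have hpv : (p (i + 1)).1 ≠ v := fun h => hne' (i + 1) (Nat.succ_pos i) (Subtype.ext h)
      obtain ⟨α, h⟩ := hp.2 (i + 1)
      rcases h with h | ⟨-, m, h, hm⟩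
      · exact absurd h.1 hpv
      -- The labels `1, …, n - 1` have been removed and those from `n` on do not occur inside the
      -- loop, so only `0` is left.
      · have hlt := hmark _ (p (i + 1)).2 hpv _ _ _ h
        obtain rfl : m = 0 := hm.elim id fun hm => by omega
        exact ⟨α, h⟩
    · intro y hy
      rcases hgen _ y.2 with h | ⟨X, -, h⟩
      · exact Subtype.ext h
      · have hy' : y.1.1.Terminates := hy
        rw [h] at hy'
        exact absurd hy' (hc.not_terminates (not_terminates_stack X e))
  · rintro ⟨p, -, hp⟩
    exact not_forall_bodyStep (fun i => (p i).1) hp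

theorem weaklyGuarded_oneChart (x : StarExp A) : x.oneChart.WeaklyGuarded := by
  intro v hv
  obtain ⟨p, -, hp⟩ := hv.exists_infinite_path
  refine not_forall_bodyStep (fun i => (p i).1) fun i => ?_
  obtain ⟨n, h⟩ := hp i
  obtain rfl := h.marking_eq_zero rfl
  exact ⟨_, h⟩

end StackedExp

/-! ### The semilattice of star expressions modulo provable equality -/

/-- Provable equality in `Mil⁻ + Γ`. -/
def milSetoid {A : Type u} (Γ : Set (StarEq A)) : Setoid (StarExp A) where
  r := ELDerivable (milMinusPlus Γ)
  iseqv := ⟨ELDerivable.refl, fun h => ELDerivable.symm _ _ h,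
    fun h h' => ELDerivable.trans _ _ _ h h'⟩

/-- Star expressions modulo provable equality in `Mil⁻ + Γ`. -/
def MilQuot {A : Type u} (Γ : Set (StarEq A)) : Type u := Quotient (milSetoid Γ)

namespace MilQuot

variable {A : Type u} {Γ : Set (StarEq A)}

/-- The class of a star expression. -/
def mk (Γ : Set (StarEq A)) (e : StarExp A) : MilQuot Γ := Quotient.mk (milSetoid Γ) e

theorem mk_eq_iff {e f : StarExp A} : mk Γ e = mk Γ f ↔ ELDerivable (milMinusPlus Γ) e f :=
  Quotient.eq (r := milSetoid Γ)

theorem mk_eq_of_axiom {e f : StarExp A} (h : MilMinusAxiom (e, f)) : mk Γ e = mk Γ f :=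
  mk_eq_iff.2 (ELDerivable.ax _ _ (Or.inl h))

/-- Addition of classes. -/
def add : MilQuot Γ → MilQuot Γ → MilQuot Γ :=
  Quotient.map₂ StarExp.add fun e e' h f f' h' =>
    ELDerivable.trans _ _ _ (ELDerivable.cxt (.addLeft .hole f) e e' h)
      (ELDerivable.cxt (.addRight e' .hole) f f' h')

instance : Mul (MilQuot Γ) where
  mul := Quotient.map₂ StarExp.mul fun e e' h f f' h' =>
    ELDerivable.trans _ _ _ (ELDerivable.cxt (.mulLeft .hole f) e e' h)
      (ELDerivable.cxt (.mulRight e' .hole) f f' h')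

theorem mk_star_congr {e f : StarExp A} (h : mk Γ e = mk Γ f) :
    mk Γ (.star e) = mk Γ (.star f) :=
  mk_eq_iff.2 (ELDerivable.cxt (.star .hole) e f (mk_eq_iff.1 h))

theorem ind {p : MilQuot Γ → Prop} (h : ∀ e, p (mk Γ e)) (q : MilQuot Γ) : p q :=
  Quotient.ind h q

protected theorem add_comm (p q : MilQuot Γ) : p.add q = q.add p := by
  induction p using ind with | _ e
  induction q using ind with | _ f
  exact mk_eq_of_axiom (.comm_add e f)

protected theorem add_assoc (p q r : MilQuot Γ) : (p.add q).add r = p.add (q.add r) := by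
  induction p using ind with | _ e
  induction q using ind with | _ f
  induction r using ind with | _ g
  exact mk_eq_of_axiom (.assoc_add e f g)

protected theorem add_self (p : MilQuot Γ) : p.add p = p := by
  induction p using ind with | _ e
  exact mk_eq_of_axiom (.idempot_add e)

instance : Max (MilQuot Γ) := ⟨add⟩

instance : SemilatticeSup (MilQuot Γ) :=
  SemilatticeSup.mk' MilQuot.add_comm MilQuot.add_assoc MilQuot.add_self

instance : OrderBot (MilQuot Γ) where
  bot := mk Γ .zero
  bot_le q := by
    induction q using ind with | _ e
    refine sup_eq_left.1 ?_
    exact mk_eq_of_axiom (.neutral_add e)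

theorem mk_zero : mk Γ .zero = ⊥ := rfl

theorem mk_add (e f : StarExp A) : mk Γ (.add e f) = mk Γ e ⊔ mk Γ f := rfl

theorem mk_mul (e f : StarExp A) : mk Γ (.mul e f) = mk Γ e * mk Γ f := rfl

protected theorem mul_assoc (p q r : MilQuot Γ) : p * q * r = p * (q * r) := by
  induction p using ind with | _ e
  induction q using ind with | _ f
  induction r using ind with | _ g
  exact mk_eq_of_axiom (.assoc_mul e f g)

theorem sup_mul (p q r : MilQuot Γ) : (p ⊔ q) * r = p * r ⊔ q * r := by
  induction p using ind with | _ e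
  induction q using ind with | _ f
  induction r using ind with | _ g
  exact mk_eq_of_axiom (.r_distr e f g)

theorem bot_mul (q : MilQuot Γ) : ⊥ * q = ⊥ := by
  induction q using ind with | _ e
  exact mk_eq_of_axiom (.deadlock e)

theorem mk_one_mul (q : MilQuot Γ) : mk Γ .one * q = q := by
  induction q using ind with | _ e
  exact mk_eq_of_axiom (.id_left e)

theorem mul_mk_one (q : MilQuot Γ) : q * mk Γ .one = q := by
  induction q using ind with | _ e
  exact mk_eq_of_axiom (.id_right e)

theorem mk_star (e : StarExp A) :
    mk Γ (.star e) = mk Γ .one ⊔ mk Γ e * mk Γ (.star e) :=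
  mk_eq_of_axiom (.rec_star e)

theorem mk_star_one_add (e : StarExp A) : mk Γ (.star (.add .one e)) = mk Γ (.star e) :=
  (mk_eq_of_axiom (.trm_body e)).symm

/-- Right distributivity handles binary joins and `0 · c = 0` the empty one; finiteness of `s`
reduces the claim to these. -/
theorem _root_.IsLUB.image_mul_right {s : Set (MilQuot Γ)} (hs : s.Finite) {q : MilQuot Γ}
    (h : IsLUB s q) (c : MilQuot Γ) : IsLUB ((· * c) '' s) (q * c) := by
  have h₁ : IsLUB (id '' (hs.toFinset : Set (MilQuot Γ))) (hs.toFinset.sup id) :=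
    Finset.isLUB_sup
  rw [Set.image_id, hs.coe_toFinset] at h₁
  rw [h.unique h₁]
  have h₃ := Finset.apply_sup_eq_sup_comp
    (fun p : MilQuot Γ => p * c) (fun _ _ => sup_mul _ _ c) (bot_mul c)
    (s := hs.toFinset) (f := id)
  have h₂ := Finset.isLUB_sup (s := hs.toFinset) (f := (· * c) ∘ id)
  rw [hs.coe_toFinset] at h₂
  exact h₃ ▸ h₂

theorem mk_foldl_add (l : List (StarExp A)) (e : StarExp A) :
    IsLUB (mk Γ '' {x | x ∈ e :: l}) (mk Γ (l.foldl StarExp.add e)) := by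
  induction l using List.reverseRecOn with
  | nil => simp
  | append_singleton l f ih =>
    have h := ih.union (isLUB_singleton (a := mk Γ f))
    rw [List.foldl_append]
    refine (congrArg (IsLUB · _) ?_).mp h
    ext q
    simp only [Set.mem_union, Set.mem_image, Set.mem_ofPred_eq, List.mem_cons, List.mem_append,
      Set.mem_singleton_iff, List.not_mem_nil, or_false]
    grind

theorem isLUB_mk_sum (l : List (StarExp A)) :
    IsLUB (mk Γ '' {x | x ∈ l}) (mk Γ (StarExp.sum l)) := by
  cases l with
  | nil => simp [StarExp.sum, mk_zero]
  | cons e l => exact mk_foldl_add l e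

/-- Reading the sum as a least upper bound makes the order and repetitions in the list of
transitions irrelevant. -/
theorem isSolutionAt {C : OneChart A} {s : C.V → StarExp A} {v : C.V} {q : MilQuot Γ}
    (hfin : {t : Option A × C.V | C.Trans v t.1 t.2}.Finite)
    (hq : IsLUB ((fun t : Option A × C.V => mk Γ (OneChart.labelExp t.1) * mk Γ (s t.2)) ''
      {t | C.Trans v t.1 t.2}) q)
    (hv : mk Γ (s v) = mk Γ (C.termConst v) ⊔ q) :
    C.IsSolutionAt (milMinusPlus Γ) s v := by
  refine ⟨hfin.toFinset.toList, fun t => by simp, mk_eq_iff.1 ?_⟩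
  rw [mk_add, hv]
  congr 1
  refine hq.unique ((congrArg (IsLUB · _) ?_).mp (isLUB_mk_sum _))
  ext r
  simp [mk_mul]

end MilQuot

/-! ### The fundamental theorem for stacked star expressions -/

namespace StackedExp

variable {A : Type u}

open MilQuot OneChart

/-- The transitions from `E`. -/
def trans (E : StackedExp A) : Set (Option A × StackedExp A) := {t | ∃ n, Step E t.1 n t.2}

theorem trans_add (e₁ e₂ : StarExp A) :
    trans (add e₁ e₂) = trans e₁.toStacked ∪ trans e₂.toStacked := by
  ext ⟨α, E'⟩
  constructor
  · rintro ⟨n, h⟩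
    cases h with
    | add_left _ _ _ _ _ h => exact Or.inl ⟨_, h⟩
    | add_right _ _ _ _ _ h => exact Or.inr ⟨_, h⟩
  · rintro (⟨n, h⟩ | ⟨n, h⟩) <;> obtain ⟨a, rfl⟩ := Step.exists_eq_some h
    · exact ⟨0, Step.add_left _ _ _ _ _ h⟩
    · exact ⟨0, Step.add_right _ _ _ _ _ h⟩

theorem trans_star (e : StarExp A) :
    trans (star e) = (fun t => (t.1, stack t.2 e)) '' trans e.toStacked := by
  ext ⟨α, E'⟩
  constructor
  · rintro ⟨n, h⟩
    obtain ⟨a, m, X, rfl, h', h⟩ := Step.of_star h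
    exact ⟨(some a, X), ⟨m, h⟩, Prod.ext rfl h'.symm⟩
  · rintro ⟨⟨β, X⟩, ⟨n, h⟩, ht⟩
    cases ht
    obtain ⟨a, rfl⟩ := Step.exists_eq_some h
    by_cases hn : e.NormedPlus
    · exact ⟨_, Step.star_entry _ _ _ _ h hn⟩
    · exact ⟨_, Step.star_body _ _ _ _ h hn⟩

theorem trans_mul (E : StackedExp A) (e : StarExp A) :
    trans (mul E e) = (fun t => (t.1, mul t.2 e)) '' trans E ∪
      {t | E.Terminates ∧ t ∈ trans e.toStacked} := by
  ext ⟨α, E'⟩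
  constructor
  · rintro ⟨n, h⟩
    cases h with
    | mul_left _ _ _ _ _ h => exact Or.inl ⟨(α, _), ⟨_, h⟩, rfl⟩
    | mul_right _ _ _ _ _ hE h => exact Or.inr ⟨hE, _, h⟩
  · rintro (⟨⟨β, X⟩, ⟨n, h⟩, ht⟩ | ⟨hE, n, h⟩)
    · cases ht
      exact ⟨n, Step.mul_left _ _ _ _ _ h⟩
    · obtain ⟨a, rfl⟩ := Step.exists_eq_some h
      exact ⟨0, Step.mul_right _ _ _ _ _ hE h⟩

theorem trans_stack (E : StackedExp A) (e : StarExp A) :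
    trans (stack E e) = (fun t => (t.1, stack t.2 e)) '' trans E ∪
      {t | E.Terminates ∧ t = (none, star e)} := by
  ext ⟨α, E'⟩
  constructor
  · rintro ⟨n, h⟩
    cases h with
    | stack_left _ _ _ _ _ h => exact Or.inl ⟨(α, _), ⟨_, h⟩, rfl⟩
    | stack_right _ _ hE => exact Or.inr ⟨hE, rfl⟩
  · rintro (⟨⟨β, X⟩, ⟨n, h⟩, ht⟩ | ⟨hE, ht⟩)
    · cases ht
      exact ⟨n, Step.stack_left _ _ _ _ _ h⟩
    · cases ht
      exact ⟨0, Step.stack_right _ _ hE⟩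

theorem trans_zero : trans (zero : StackedExp A) = ∅ := by
  ext t
  exact ⟨fun ⟨_, h⟩ => (by cases h), False.elim⟩

theorem trans_one : trans (one : StackedExp A) = ∅ := by
  ext t
  exact ⟨fun ⟨_, h⟩ => (by cases h), False.elim⟩

theorem trans_act (a : A) : trans (act a) = {(some a, one)} := by
  ext ⟨α, E'⟩
  constructor
  · rintro ⟨_, h⟩
    cases h
    rfl
  · intro h
    cases h
    exact ⟨0, Step.act a⟩

open Classical in
/-- The termination constant at `E`. -/
noncomputable def termConst (E : StackedExp A) : StarExp A :=
  if E.Terminates then StarExp.one else StarExp.zero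

theorem termConst_of_terminates {E : StackedExp A} (h : E.Terminates) :
    E.termConst = StarExp.one := if_pos h

theorem termConst_of_not_terminates {E : StackedExp A} (h : ¬ E.Terminates) :
    E.termConst = StarExp.zero := if_neg h

theorem termConst_congr {E E' : StackedExp A} (h : E.Terminates ↔ E'.Terminates) :
    E.termConst = E'.termConst := by
  by_cases hE : E.Terminates
  · rw [termConst_of_terminates hE, termConst_of_terminates (h.1 hE)]
  · rw [termConst_of_not_terminates hE, termConst_of_not_terminates (mt h.2 hE)]

/-- The class of the summand for a transition to a vertex with value given by `σ`. -/
def summand (Γ : Set (StarEq A)) (σ : StackedExp A → StarExp A) (t : Option A × StackedExp A) :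
    MilQuot Γ :=
  MilQuot.mk Γ (labelExp t.1) * MilQuot.mk Γ (σ t.2)

/-- `σ` satisfies at `E` the equation for provable solutions, with finitely many transitions. -/
def Solves (Γ : Set (StarEq A)) (σ : StackedExp A → StarExp A) (E : StackedExp A) : Prop :=
  (trans E).Finite ∧ ∃ q : MilQuot Γ, IsLUB (summand Γ σ '' trans E) q ∧
    MilQuot.mk Γ (σ E) = MilQuot.mk Γ E.termConst ⊔ q

variable {Γ : Set (StarEq A)}

/-- By associativity, `α · (σ(E) · x) = (α · σ(E)) · x`, so a right factor can be pulled out of the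
whole sum. Separate `σ` and `σ'` allow passing from `π` to the left-hand sides of the coinductive
proof. -/
theorem isLUB_summand_image {s : Set (Option A × StackedExp A)} (hs : s.Finite) {q : MilQuot Γ}
    {σ σ' : StackedExp A → StarExp A} (h : IsLUB (summand Γ σ '' s) q)
    {k : StackedExp A → StackedExp A} {x : StarExp A}
    (hk : ∀ t ∈ s, σ' (k t.2) = (σ t.2).mul x) :
    IsLUB (summand Γ σ' '' ((fun t => (t.1, k t.2)) '' s)) (q * MilQuot.mk Γ x) := by
  have := h.image_mul_right (hs.image _) (MilQuot.mk Γ x)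
  rw [Set.image_image] at this ⊢
  refine (congrArg (IsLUB · _) (Set.image_congr fun t ht => ?_)).mp this
  simp only [summand, hk t ht, mk_mul, MilQuot.mul_assoc]

theorem Solves.mul {E : StackedExp A} {e : StarExp A} (hE : Solves Γ proj E)
    (he : Solves Γ proj e.toStacked) : Solves Γ proj (mul E e) := by
  obtain ⟨fE, q, hq, hE⟩ := hE
  obtain ⟨fe, r, hr, he⟩ := he
  have h := isLUB_summand_image (σ' := proj) fE hq (k := (StackedExp.mul · e)) (x := e)
    fun _ _ => rfl
  rw [Solves, trans_mul]
  by_cases ht : E.Terminates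
  · simp only [ht, true_and, Set.ofPred_mem_eq]
    refine ⟨(fE.image _).union fe, _, by rw [Set.image_union]; exact h.union hr, ?_⟩
    have hterm : (StackedExp.mul E e).termConst = e.toStacked.termConst := 
      termConst_congr ((terminates_mul.trans (and_iff_right ht)).trans terminates_toStacked.symm)
    rw [StarExp.proj_toStacked] at he
    rw [proj, mk_mul, hE, termConst_of_terminates ht, sup_mul, mk_one_mul, hterm,
      sup_comm (q * _), ← sup_assoc, ← he]
  · simp only [ht, false_and, Set.ofPred_false, Set.union_empty]
    refine ⟨fE.image _, _, h, ?_⟩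
    rw [proj, mk_mul, hE, termConst_of_not_terminates ht,
      termConst_of_not_terminates fun h' => ht (terminates_mul.1 h').1, sup_mul, mk_zero, bot_mul]

theorem Solves.stack {E : StackedExp A} (hE : Solves Γ proj E) (e : StarExp A) :
    Solves Γ proj (stack E e) := by
  obtain ⟨fE, q, hq, hE⟩ := hE
  have h := isLUB_summand_image (σ' := proj) fE hq (k := (StackedExp.stack · e))
    (x := StarExp.star e) fun _ _ => rfl
  rw [Solves, trans_stack, termConst_of_not_terminates (not_terminates_stack E e)]
  by_cases ht : E.Terminates
  · simp only [ht, true_and, Set.ofPred_eq_eq_singleton]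
    refine ⟨(fE.image _).union (Set.finite_singleton _), _,
      by rw [Set.image_union, Set.image_singleton]; exact h.union isLUB_singleton, ?_⟩
    rw [proj, mk_mul, hE, termConst_of_terminates ht, sup_mul, mk_zero, bot_sup_eq, sup_comm]
    rfl
  · simp only [ht, false_and, Set.ofPred_false, Set.union_empty]
    refine ⟨fE.image _, _, h, ?_⟩
    rw [proj, mk_mul, hE, termConst_of_not_terminates ht, sup_mul, mk_zero, bot_mul]

theorem Solves.star {e : StarExp A} (he : Solves Γ proj e.toStacked) :
    Solves Γ proj (star e) := by
  obtain ⟨fe, q, hq, he⟩ := he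
  have h := isLUB_summand_image (σ' := proj) fe hq (k := (StackedExp.stack · e))
    (x := StarExp.star e) fun _ _ => rfl
  rw [Solves, trans_star, termConst_of_terminates (terminates_star e)]
  refine ⟨fe.image _, _, h, ?_⟩
  rw [StarExp.proj_toStacked] at he
  change MilQuot.mk Γ (StarExp.star e) = _
  -- With a representative `x` of the sum, `e` equals `x` or `1 + x`. In both cases `e* = x*`, in
  -- the second by the axiom `x* = (1 + x)*`, and unfolding `x*` gives the equation.
  induction q using MilQuot.ind with | _ x
  have hx : MilQuot.mk Γ (StarExp.star e) = MilQuot.mk Γ (StarExp.star x) := by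
    by_cases ht : e.Terminates
    · rw [termConst_of_terminates (terminates_toStacked.2 ht)] at he
      rw [← mk_star_one_add x]
      exact mk_star_congr he
    · rw [termConst_of_not_terminates (mt terminates_toStacked.1 ht), mk_zero, bot_sup_eq] at he
      exact mk_star_congr he
  rw [hx, ← mk_star]

theorem Solves.add {e₁ e₂ : StarExp A} (h₁ : Solves Γ proj e₁.toStacked)
    (h₂ : Solves Γ proj e₂.toStacked) : Solves Γ proj (add e₁ e₂) := by
  obtain ⟨f₁, q₁, hq₁, h₁⟩ := h₁
  obtain ⟨f₂, q₂, hq₂, h₂⟩ := h₂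
  rw [Solves, trans_add, Set.image_union]
  refine ⟨f₁.union f₂, _, hq₁.union hq₂, ?_⟩
  rw [StarExp.proj_toStacked] at h₁ h₂
  have hterm : MilQuot.mk Γ (StackedExp.add e₁ e₂).termConst =
      MilQuot.mk Γ e₁.toStacked.termConst ⊔ MilQuot.mk Γ e₂.toStacked.termConst := by
    by_cases t₁ : e₁.Terminates
    · rw [termConst_of_terminates (terminates_add.2 (Or.inl t₁)),
        termConst_of_terminates (terminates_toStacked.2 t₁)]
      by_cases t₂ : e₂.Terminates
      · rw [termConst_of_terminates (terminates_toStacked.2 t₂), sup_idem]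
      · rw [termConst_of_not_terminates (mt terminates_toStacked.1 t₂), mk_zero, sup_bot_eq]
    · rw [termConst_of_not_terminates (mt terminates_toStacked.1 t₁), mk_zero, bot_sup_eq]
      exact congrArg _ (termConst_congr ((terminates_add.trans (or_iff_right t₁)).trans
        terminates_toStacked.symm))
  rw [proj, mk_add, h₁, h₂, hterm, sup_sup_sup_comm]

theorem solves_zero : Solves Γ proj (zero : StackedExp A) := by
  rw [Solves, trans_zero, termConst_of_not_terminates not_terminates_zero, Set.image_empty]
  exact ⟨Set.finite_empty, ⊥, isLUB_empty, rfl.trans (sup_bot_eq _).symm⟩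

theorem solves_one : Solves Γ proj (one : StackedExp A) := by
  rw [Solves, trans_one, termConst_of_terminates terminates_one, Set.image_empty]
  exact ⟨Set.finite_empty, ⊥, isLUB_empty, rfl.trans (sup_bot_eq _).symm⟩

theorem solves_act (a : A) : Solves Γ proj (act a) := by
  rw [Solves, trans_act, termConst_of_not_terminates (not_terminates_act a), Set.image_singleton]
  refine ⟨Set.finite_singleton _, _, isLUB_singleton, ?_⟩
  rw [mk_zero, bot_sup_eq]
  exact (mul_mk_one _).symm

theorem solves_proj_toStacked (e : StarExp A) : Solves Γ proj e.toStacked := by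
  induction e with
  | zero => exact solves_zero
  | one => exact solves_one
  | act a => exact solves_act a
  | add _ _ h₁ h₂ => exact h₁.add h₂
  | mul _ _ h₁ h₂ => exact h₁.mul h₂
  | star _ h => exact h.star

theorem solves_proj (E : StackedExp A) : Solves Γ proj E := by
  induction E with
  | zero => exact solves_zero
  | one => exact solves_one
  | act a => exact solves_act a
  | add e₁ e₂ => exact (solves_proj_toStacked e₁).add (solves_proj_toStacked e₂)
  | mul _ e h => exact h.mul (solves_proj_toStacked e)
  | star e => exact (solves_proj_toStacked e).star
  | stack _ e h => exact h.stack e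

theorem Solves.isSolutionAt {x : StarExp A} {σ : StackedExp A → StarExp A} (v : x.oneChart.V)
    (h : Solves Γ σ v.1) :
    x.oneChart.IsSolutionAt (milMinusPlus Γ) (fun w => σ w.1) v := by
  obtain ⟨hf, q, hq, hv⟩ := h
  refine MilQuot.isSolutionAt (q := q) ?_ ?_ hv
  · exact hf.preimage (f := Prod.map id Subtype.val)
      (Function.injective_id.prodMap Subtype.val_injective).injOn
  · refine (congrArg (IsLUB · _) ?_).mp hq
    ext r
    constructor
    · rintro ⟨⟨α, E'⟩, ⟨n, ht⟩, rfl⟩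
      exact ⟨(α, ⟨E', Relation.ReflTransGen.tail v.2 ⟨α, n, ht⟩⟩), ⟨n, ht⟩, rfl⟩
    · rintro ⟨⟨α, w⟩, ht, rfl⟩
      exact ⟨(α, w.1), ht, rfl⟩

/-! ### Vertices of the 1-chart interpretation of `f* · g` -/

theorem IsIteratedDerivative.of_step {e : StarExp A} {E : StackedExp A} {α : Option A} {n : ℕ}
    (h : Step e.toStacked α n E) : IsIteratedDerivative e E :=
  Relation.TransGen.single ⟨α, n, h⟩

theorem IsIteratedDerivative.step {e : StarExp A} {E E' : StackedExp A} {α : Option A} {n : ℕ}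
    (hE : IsIteratedDerivative e E) (h : Step E α n E') : IsIteratedDerivative e E' :=
  Relation.TransGen.tail hE ⟨α, n, h⟩

theorem trans_star_mul (f g : StarExp A) :
    trans (mul (star f) g) =
      (fun t => (t.1, mul (stack t.2 f) g)) '' trans f.toStacked ∪ trans g.toStacked := by
  simp only [trans_mul, trans_star, Set.image_image, terminates_star, true_and, Set.ofPred_mem_eq]

theorem trans_stack_mul (F : StackedExp A) (f g : StarExp A) :
    trans (mul (stack F f) g) = (fun t => (t.1, mul (stack t.2 f) g)) '' trans F ∪
      {t | F.Terminates ∧ t = (none, mul (star f) g)} := by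
  rw [trans_mul, trans_stack, Set.image_union, Set.image_image]
  ext t
  simp only [not_terminates_stack, false_and, Set.ofPred_false, Set.union_empty]
  refine or_congr Iff.rfl ⟨?_, ?_⟩
  · rintro ⟨_, ⟨h, rfl⟩, rfl⟩
    exact ⟨h, rfl⟩
  · rintro ⟨h, rfl⟩
    exact ⟨_, ⟨h, rfl⟩, rfl⟩

theorem isVertexOf_star_mul_iff (f g : StarExp A) (E : StackedExp A) :
    IsVertexOf (f.star.mul g) E ↔ E = (f.star.mul g).toStacked ∨
      (∃ F : StackedExp A, IsIteratedDerivative f F ∧ E = (F.stack f).mul g) ∨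
      IsIteratedDerivative g E := by
  constructor
  · intro h
    induction (h : Relation.ReflTransGen Arrow _ E) with
    | refl => exact Or.inl rfl
    | @tail X Y _ h ih =>
      obtain ⟨α, n, h⟩ := h
      rcases ih with rfl | ⟨F, hF, rfl⟩ | hX
      · have ht : (α, Y) ∈ trans (mul (star f) g) := ⟨n, h⟩
        rw [trans_star_mul] at ht
        rcases ht with ⟨⟨β, F⟩, ⟨m, hF⟩, ht⟩ | ⟨m, ht⟩
        · cases ht
          exact Or.inr (Or.inl ⟨F, .of_step hF, rfl⟩)
        · exact Or.inr (Or.inr (.of_step ht))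
      · have ht : (α, Y) ∈ trans (mul (stack F f) g) := ⟨n, h⟩
        rw [trans_stack_mul] at ht
        rcases ht with ⟨⟨β, F'⟩, ⟨m, hF'⟩, ht⟩ | ⟨-, ht⟩
        · cases ht
          exact Or.inr (Or.inl ⟨F', hF.step hF', rfl⟩)
        · cases ht
          exact Or.inl rfl
      · exact Or.inr (Or.inr (hX.step h))
  · rintro (rfl | ⟨F, hF, rfl⟩ | hE)
    · exact Relation.ReflTransGen.refl
    · induction (hF : Relation.TransGen Arrow f.toStacked F) with
      | @single F h =>
        obtain ⟨α, n, h⟩ := h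
        have ht : (α, mul (stack F f) g) ∈ trans (mul (star f) g) := by
          rw [trans_star_mul]
          exact Or.inl ⟨(α, _), ⟨n, h⟩, rfl⟩
        exact Relation.ReflTransGen.single ⟨α, ht⟩
      | tail _ h ih =>
        obtain ⟨α, n, h⟩ := h
        exact Relation.ReflTransGen.tail ih
          ⟨α, n, Step.mul_left _ _ _ _ _ (Step.stack_left _ _ _ _ _ h)⟩
    · obtain ⟨X, ⟨α, n, h⟩, hX⟩ := Relation.TransGen.head'_iff.1 hE
      have ht : (α, X) ∈ trans (mul (star f) g) := by
        rw [trans_star_mul]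
        exact Or.inr ⟨n, h⟩
      exact Relation.ReflTransGen.head ⟨α, ht⟩ hX

/-! ### The coinductive proof -/

open Classical in
/-- The left-hand sides of the equations of the coinductive proof of `e = f* · g`. -/
noncomputable def lhs (e f g : StarExp A) (E : StackedExp A) : StarExp A :=
  if E = (f.star.mul g).toStacked then e
  else if h : ∃ F : StackedExp A, E = (F.stack f).mul g then h.choose.proj.mul e
  else E.proj

theorem lhs_star_mul (e f g : StarExp A) : lhs e f g (mul (star f) g) = e :=
  if_pos rfl

theorem lhs_stack_mul (e f g : StarExp A) (F : StackedExp A) :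
    lhs e f g (mul (stack F f) g) = F.proj.mul e := by
  have h : ∃ F' : StackedExp A, mul (stack F f) g = (F'.stack f).mul g := ⟨F, rfl⟩
  have hF : h.choose = F := by
    have := h.choose_spec
    injection this with this
    injection this with this
    exact this.symm
  rw [lhs, if_neg (by rintro ⟨⟩), dif_pos h, hF]

/-- The first two kinds of vertices are products with right factor `g`, hence no derivatives of `g`;
so the prescribed left-hand sides do not conflict. -/
theorem lhs_of_isIteratedDerivative (e f : StarExp A) {g : StarExp A} {G : StackedExp A}
    (hG : IsIteratedDerivative g G) : lhs e f g G = G.proj := by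
  have h := hG.mem_derivBound
  have hne : ∀ X, G ≠ mul X g := fun X hX => mul_not_mem_derivBound g X (hX ▸ h)
  have hne' : G ≠ (f.star.mul g).toStacked := hne f.star.toStacked
  rw [lhs, if_neg hne', dif_neg fun ⟨F, hF⟩ => hne _ hF]

theorem isLUB_summand_lhs {s : Set (Option A × StackedExp A)} {e f g : StarExp A} {q : MilQuot Γ}
    (h : IsLUB (summand Γ proj '' s) q) (hs : ∀ t ∈ s, IsIteratedDerivative g t.2) :
    IsLUB (summand Γ (lhs e f g) '' s) q := by
  refine (congrArg (IsLUB · _) (Set.image_congr fun t ht => ?_)).mp h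
  rw [summand, summand, lhs_of_isIteratedDerivative e f (hs t ht)]

theorem solves_lhs_of_isIteratedDerivative (e f : StarExp A) {g : StarExp A} {G : StackedExp A}
    (hG : IsIteratedDerivative g G) : Solves Γ (lhs e f g) G := by
  obtain ⟨hfin, q, hq, h⟩ := solves_proj (Γ := Γ) G
  refine ⟨hfin, q, isLUB_summand_lhs hq fun t ⟨_, ht⟩ => hG.step ht, ?_⟩
  rw [lhs_of_isIteratedDerivative e f hG, h]

theorem solves_lhs_star_mul {e f g : StarExp A} (hf : ¬ f.Terminates)
    (he : MilQuot.mk Γ e = MilQuot.mk Γ ((f.mul e).add g)) :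
    Solves Γ (lhs e f g) (mul (star f) g) := by
  obtain ⟨ff, q, hq, hfq⟩ := solves_proj_toStacked (Γ := Γ) f
  obtain ⟨fg, r, hr, hgr⟩ := solves_proj_toStacked (Γ := Γ) g
  rw [StarExp.proj_toStacked] at hfq hgr
  rw [termConst_of_not_terminates (mt terminates_toStacked.1 hf), mk_zero, bot_sup_eq] at hfq
  have hl := isLUB_summand_image (σ' := lhs e f g) ff hq (k := fun X => mul (stack X f) g)
    (x := e) fun t _ => lhs_stack_mul e f g t.2
  have hr' : IsLUB (summand Γ (lhs e f g) '' trans g.toStacked) r :=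
    isLUB_summand_lhs hr fun t ⟨_, ht⟩ => .of_step ht
  have hterm : (mul (star f) g).termConst = g.toStacked.termConst :=
    termConst_congr ((terminates_mul.trans (and_iff_right (terminates_star f))).trans
      terminates_toStacked.symm)
  rw [Solves, trans_star_mul]
  refine ⟨(ff.image _).union fg, _, by rw [Set.image_union]; exact hl.union hr', ?_⟩
  -- With `f = q` and `g = τ(g) + r`, the required right-hand side `τ(g) + (q · e + r)` regroups to
  -- `f · e + g`.
  rw [lhs_star_mul, hterm, sup_left_comm, ← hgr, ← hfq]
  exact he

theorem solves_lhs_stack_mul (e f g : StarExp A) (F : StackedExp A) :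
    Solves Γ (lhs e f g) (mul (stack F f) g) := by
  obtain ⟨hfin, q, hq, h⟩ := solves_proj (Γ := Γ) F
  have hl := isLUB_summand_image (σ' := lhs e f g) hfin hq (k := fun X => mul (stack X f) g)
    (x := e) fun t _ => lhs_stack_mul e f g t.2
  rw [Solves, trans_stack_mul, lhs_stack_mul, mk_mul, h, sup_mul, termConst_of_not_terminates
    fun h => not_terminates_stack F f (terminates_mul.1 h).1, mk_zero]
  by_cases ht : F.Terminates
  · simp only [ht, true_and, Set.ofPred_eq_eq_singleton]
    refine ⟨(hfin.image _).union (Set.finite_singleton _), _,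
      by rw [Set.image_union, Set.image_singleton]; exact hl.union isLUB_singleton, ?_⟩
    -- The summand `1 · e` that comes from `τ(F) · e` is the one of the 1-transition back to `f* ·
    -- g`, where the value is `e`.
    rw [termConst_of_terminates ht, bot_sup_eq, sup_comm, summand, lhs_star_mul]
    rfl
  · simp only [ht, false_and, Set.ofPred_false, Set.union_empty]
    refine ⟨hfin.image _, _, hl, ?_⟩
    rw [termConst_of_not_terminates ht, mk_zero, bot_mul]

end StackedExp

/-! ### Proof of the theorem -/

theorem mainTheorem7 {A : Type u} (e f g : StarExp A) (hf : ¬ f.Terminates) :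
    (∀ E : StackedExp A, StackedExp.IsVertexOf (f.star.mul g) E ↔
      E = (f.star.mul g).toStacked ∨
      (∃ F : StackedExp A, StackedExp.IsIteratedDerivative f F ∧ E = (F.stack f).mul g) ∨
      StackedExp.IsIteratedDerivative g E) ∧
    (f.star.mul g).oneChart.IsLLEEWitness (f.star.mul g).entryBodyLabeling ∧
    ∃ L : (f.star.mul g).oneChart.V → StarEq A,
      (f.star.mul g).oneChart.IsLLEECoinductiveProof (milMinusPlus {(e, (f.mul e).add g)}) L e
        (f.star.mul g) ∧
      (∀ v : (f.star.mul g).oneChart.V,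
        (v.1 = (f.star.mul g).toStacked → (L v).1 = e) ∧
        (∀ F : StackedExp A, StackedExp.IsIteratedDerivative f F → v.1 = (F.stack f).mul g →
          (L v).1 = F.proj.mul e) ∧
        (∀ G : StackedExp A, StackedExp.IsIteratedDerivative g G → v.1 = G →
          (L v).1 = G.proj) ∧
        (L v).2 = v.1.proj) := by
  have hlhs : ∀ E : StackedExp A, StackedExp.IsVertexOf (f.star.mul g) E →
      StackedExp.Solves {(e, (f.mul e).add g)} (StackedExp.lhs e f g) E := by
    intro E hE
    rcases (StackedExp.isVertexOf_star_mul_iff f g E).1 hE with rfl | ⟨F, -, rfl⟩ | hE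
    · exact StackedExp.solves_lhs_star_mul hf
        (MilQuot.mk_eq_iff.2 (ELDerivable.ax _ _ (Or.inr rfl)))
    · exact StackedExp.solves_lhs_stack_mul e f g F
    · exact StackedExp.solves_lhs_of_isIteratedDerivative e f hE
  refine ⟨StackedExp.isVertexOf_star_mul_iff f g,
    StackedExp.isLLEEWitness_entryBodyLabeling _,
    fun v => (StackedExp.lhs e f g v.1, v.1.proj), ⟨⟨StackedExp.weaklyGuarded_oneChart _,
      fun v => (hlhs v.1 v.2).isSolutionAt v, fun v => (StackedExp.solves_proj v.1).isSolutionAt v,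
      StackedExp.lhs_star_mul e f g, StarExp.proj_toStacked _⟩,
      _, StackedExp.isLLEEWitness_entryBodyLabeling _⟩, fun v => ⟨?_, ?_, ?_, rfl⟩⟩
  · intro hv
    exact (congrArg _ hv).trans (StackedExp.lhs_star_mul e f g)
  · intro F _ hv
    exact (congrArg _ hv).trans (StackedExp.lhs_stack_mul e f g F)
  · rintro G hG rfl
    exact StackedExp.lhs_of_isIteratedDerivative e f hG
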